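/- Let $x(s)$, $s\in\mathbb R^d$, be a centered Gaussian process with continuous sample paths, and let $\Gamma$ be a group of homeomorphisms of $\mathbb R^d$ such that for every $g\in\Gamma$ the processes $\{x(gs)\}$ and $\{x(s)\}$ have the same finite-dimensional distributions. Let $(\Delta_T)_{T>0}$ be subsets of $\mathbb R^d$ with $\Delta_T\subset\Delta_{T'}$ for $T<T'$ and $E\,x(t)x(s)>0$ for all $s,t\in\Delta_T$, $T>0$. Suppose there are integers $r_1>r_2>1$ with $\log r_1/\log r_2$ irrational and an integer $D\ge 0$ such that for every $T>0$ and each $r\in\{r_1,r_2\}$ there are $g_1,\dots,g_{r^D}\in\Gamma$ for which the sets $g_i\Delta_{T/r}$ are pairwise disjoint and $\overline{\Delta_T}=\overline{\bigcup_i g_i\Delta_{T/r}}$. Let $u\in\mathbb R$ and $P(\Delta_T)=P\{x(s)<u \text{ for all } s\in\Delta_T\}$. Then the limit $$\theta=\lim_{T\to\infty}\frac{-\log P(\Delta_T)}{T^{D}}\in[0,\infty]$$ exists (with $-\log 0=\infty$), and $\theta<\infty$ if and only if $P(\Delta_T)>0$ for some $T>0$. In particular, $\theta<\infty$ whenever all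 $\Delta_T$ are bounded and either $u>0$ or $E\,x(s)^2>0$ for all $s\in\overline{\Delta_T}$ and all $T>0$. -/

import Mathlib

open MeasureTheory ProbabilityTheory Filter Topology Set
open scoped ENNReal

/-- The process `x` on `ℝ^d` is homogeneous in the group `Γ` of continuous one-to-one
transformations of `ℝ^d` if `{x (g s)}` and `{x s}` have the same finite-dimensional
distributions for every `g ∈ Γ`. -/
def IsHomogeneousIn {d : ℕ} {Ω : Type*} [MeasurableSpace Ω] (P : Measure Ω)
    (x : EuclideanSpace ℝ (Fin d) → Ω → ℝ)
    (Γ : Subgroup (EuclideanSpace ℝ (Fin d) ≃ₜ EuclideanSpace ℝ (Fin d))) : Prop :=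
  ∀ g ∈ Γ, ∀ I : Finset (EuclideanSpace ℝ (Fin d)),
    IdentDistrib (fun ω (s : I) => x (g s) ω) (fun ω (s : I) => x s ω) P P

/-- `G` has a `Δ₀`-parquet of `n` elements: there are `n` pairwise disjoint images
`g i '' Δ₀`, `g i ∈ Γ`, such that `G` and their union have the same closure. -/
def HasParquet {d : ℕ}
    (Γ : Subgroup (EuclideanSpace ℝ (Fin d) ≃ₜ EuclideanSpace ℝ (Fin d)))
    (Δ₀ G : Set (EuclideanSpace ℝ (Fin d))) (n : ℕ) : Prop :=
  ∃ g : Fin n → (EuclideanSpace ℝ (Fin d) ≃ₜ EuclideanSpace ℝ (Fin d)),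
    (∀ i, g i ∈ Γ) ∧
    (∀ i j, i ≠ j → Disjoint (g i '' Δ₀) (g j '' Δ₀)) ∧
    closure G = closure (⋃ i, g i '' Δ₀)

/-- The probability that `x s < u` for all `s ∈ A`. -/
def probBelow {d : ℕ} {Ω : Type*} [MeasurableSpace Ω] (P : Measure Ω)
    (x : EuclideanSpace ℝ (Fin d) → Ω → ℝ) (u : ℝ)
    (A : Set (EuclideanSpace ℝ (Fin d))) : ℝ≥0∞ :=
  P {ω | ∀ s ∈ A, x s ω < u}

/-! The engine is positive association. For a centered Gaussian vector with nonnegative covariances,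
decreasing events are positively correlated, so staying below `u` on a union is at least as likely
as the product of the probabilities (`measureReal_orthant_mul_le`, extended to sets in
`probBelow_mul_le`). Together with invariance under `Γ` and a parquet this gives `P(Δ_{T/r})^(r^D) ≤
P(Δ_T)` (`probBelow_pow_le_of_hasParquet`).

Association (`integral_mul_integral_le`) is proved by interpolation. With `Y` an independent copy of
`X`, let `φ a = E f(X) g(aX + √(1-a²) Y)`, which joins `E f E g` at `a = 0` to `E fg` at `a = 1`. A
short Ornstein-Uhlenbeck step changes `φ` by a nonnegative quadratic term, built from covariances
times products of coefficients of equal sign, up to a cubic error. Quantitative first order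
expansions replace derivatives, and Gaussian smoothing preserves them with the same constant.

A parquet only matches closures, whereas the event is a strict inequality. Two sets with the same
closure could differ only when the supremum equals `u`. This has probability zero because, locally,
the process is positively correlated with one nondegenerate variable (`measure_sup_eq_zero`).

The rest is deterministic: `L(T) = -log P(Δ_T)` is nondecreasing and `L(T) ≤ r^D L(T/r)` for two
multiplicatively independent `r`, so `L(T)/T^D` tends to its infimum (`exists_tendsto_div_pow`).
Positivity at one `T` propagates to all `T`. For bounded sets it follows from compactness, path
continuity and association. -/

namespace GaussianParquet

/-! ### Rotation invariance of two independent copies of a centered Gaussian. -/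

section Rotation

variable {E : Type*} [NormedAddCommGroup E] [NormedSpace ℝ E] [MeasurableSpace E] [BorelSpace E]
  [CompleteSpace E] [SecondCountableTopology E]

/-- A centered Gaussian measure is symmetric. -/
lemma map_neg_eq_self {μ : Measure E} [IsGaussian μ] (hμ : μ[id] = 0) :
    μ.map (fun x => -x) = μ := by
  -- Rotation by `π` is `-id` on the product, so the first marginal gives the symmetry.
  have h := congrArg (Measure.map Prod.fst) (IsGaussian.map_rotation_eq_self hμ Real.pi)
  rw [Measure.map_map (by fun_prop) (by fun_prop), measurePreserving_fst.map_eq] at h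
  have h2 : (Prod.fst ∘ (ContinuousLinearMap.rotation Real.pi : E × E →L[ℝ] E × E))
      = (fun x => -x) ∘ Prod.fst := by
    funext z
    simp [ContinuousLinearMap.rotation_apply]
  rw [h2, ← Measure.map_map (by fun_prop) (by fun_prop), measurePreserving_fst.map_eq] at h
  exact h

/-- The reflection `(x, y) ↦ (a x + s y, s x - a y)`, with `a² + s² = 1`, preserves `μ.prod μ` for
a centered Gaussian measure `μ`. -/
lemma measurePreserving_reflection {μ : Measure E} [IsGaussian μ] (hμ : μ[id] = 0) {a s : ℝ}
    (has : a ^ 2 + s ^ 2 = 1) :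
    MeasurePreserving (fun z : E × E => (a • z.1 + s • z.2, s • z.1 - a • z.2))
      (μ.prod μ) (μ.prod μ) := by
  have hcos : ∃ θ : ℝ, Real.cos θ = a ∧ Real.sin θ = s := by
    refine ⟨Complex.arg ⟨a, s⟩, ?_, ?_⟩
    · have hn : ‖(⟨a, s⟩ : ℂ)‖ = 1 := by
        rw [Complex.norm_def, Complex.normSq_mk, ← sq, ← sq, has, Real.sqrt_one]
      rw [Complex.cos_arg (by intro h; simp [h] at hn), hn]; simp
    · have hn : ‖(⟨a, s⟩ : ℂ)‖ = 1 := by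
        rw [Complex.norm_def, Complex.normSq_mk, ← sq, ← sq, has, Real.sqrt_one]
      rw [Complex.sin_arg, hn]; simp
  obtain ⟨θ, rfl, rfl⟩ := hcos
  refine ⟨by fun_prop, ?_⟩
  have hneg : (μ.prod μ).map (Prod.map id (fun x => -x)) = μ.prod μ := by
    rw [← Measure.map_prod_map _ _ measurable_id (by fun_prop), map_neg_eq_self hμ,
      Measure.map_id]
  have h : (fun z : E × E =>
      (Real.cos θ • z.1 + Real.sin θ • z.2, Real.sin θ • z.1 - Real.cos θ • z.2))
      = (Prod.map id (fun x => -x)) ∘ (ContinuousLinearMap.rotation θ) := by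
    funext z
    simp only [Function.comp, ContinuousLinearMap.rotation_apply, Prod.map, id]
    congr 1
    module
  rw [h, ← Measure.map_map (by fun_prop) (by fun_prop), IsGaussian.map_rotation_eq_self hμ, hneg]

lemma integral_comp_reflection {μ : Measure E} [IsGaussian μ] (hμ : μ[id] = 0) {a s : ℝ}
    (has : a ^ 2 + s ^ 2 = 1) {h : E × E → ℝ} (hh : Measurable h) :
    ∫ z, h (a • z.1 + s • z.2, s • z.1 - a • z.2) ∂μ.prod μ = ∫ z, h z ∂μ.prod μ := by
  have hp := measurePreserving_reflection hμ has
  rw [← hp.map_eq, integral_map hp.measurable.aemeasurable hh.aestronglyMeasurable, hp.map_eq]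

/-- A linear combination of two independent copies of a centered Gaussian is a multiple of it. -/
lemma integral_linear_combination {μ : Measure E} [IsGaussian μ] (hμ : μ[id] = 0) {α β γ : ℝ}
    (h : α ^ 2 + β ^ 2 = γ ^ 2) {f : E → ℝ} (hf : Measurable f) :
    ∫ z, f (α • z.1 + β • z.2) ∂μ.prod μ = ∫ x, f (γ • x) ∂μ := by
  have hfst : ∫ x, f (γ • x) ∂μ = ∫ z, f (γ • z.1) ∂μ.prod μ := by
    simpa using (integral_fun_fst (μ := μ) (ν := μ) (fun x => f (γ • x))).symm
  rw [hfst]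
  rcases eq_or_ne γ 0 with rfl | hγ
  · have h1 : α = 0 := by nlinarith [sq_nonneg α, sq_nonneg β]
    have h2 : β = 0 := by nlinarith [sq_nonneg α, sq_nonneg β]
    simp [h1, h2]
  · have has : (α / γ) ^ 2 + (β / γ) ^ 2 = 1 := by
      field_simp
      exact h
    rw [← integral_comp_reflection hμ has (h := fun z => f (γ • z.1)) (by fun_prop)]
    congr 1
    funext z
    simp only [smul_add, smul_smul]
    congr 3 <;> field_simp

end Rotation

/-! ### Calculus of first order expansions with uniform remainder. -/

section Expansion

variable {ι : Type*} [Fintype ι]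

/-- `f` is bounded, and has first order expansions with uniformly bounded nonpositive
coefficients `p` and uniform quadratic remainder. -/
structure AntitoneExpansion (f : (ι → ℝ) → ℝ) (p : (ι → ℝ) → ι → ℝ) (K : ℝ) : Prop where
  measurable : Measurable f
  measurable_coeff : Measurable p
  abs_le : ∀ x, |f x| ≤ K
  coeff_nonpos : ∀ x i, p x i ≤ 0
  sum_coeff_le : ∀ x, ∑ i, |p x i| ≤ K
  expansion : ∀ x y, |f y - f x - ∑ i, p x i * (y i - x i)| ≤ K * ‖y - x‖ ^ 2

lemma abs_sum_mul_le {q v : ι → ℝ} {K : ℝ} (hq : ∑ i, |q i| ≤ K) :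
    |∑ i, q i * v i| ≤ K * ‖v‖ := by
  calc |∑ i, q i * v i| ≤ ∑ i, |q i * v i| := Finset.abs_sum_le_sum_abs _ _
    _ ≤ ∑ i, |q i| * ‖v‖ := by
        refine Finset.sum_le_sum fun i _ => ?_
        rw [abs_mul]
        exact mul_le_mul_of_nonneg_left (norm_le_pi_norm v i) (abs_nonneg _)
    _ = (∑ i, |q i|) * ‖v‖ := (Finset.sum_mul _ _ _).symm
    _ ≤ K * ‖v‖ := mul_le_mul_of_nonneg_right hq (norm_nonneg _)

namespace AntitoneExpansion

variable {f g : (ι → ℝ) → ℝ} {p q : (ι → ℝ) → ι → ℝ} {K L : ℝ}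

lemma bound_nonneg (hf : AntitoneExpansion f p K) : 0 ≤ K :=
  (abs_nonneg _).trans (hf.abs_le 0)

lemma mono (hf : AntitoneExpansion f p K) (hKL : K ≤ L) : AntitoneExpansion f p L where
  measurable := hf.measurable
  measurable_coeff := hf.measurable_coeff
  abs_le x := (hf.abs_le x).trans hKL
  coeff_nonpos := hf.coeff_nonpos
  sum_coeff_le x := (hf.sum_coeff_le x).trans hKL
  expansion x y := (hf.expansion x y).trans (mul_le_mul_of_nonneg_right hKL (by positivity))

/-- At distance at most `1` the quadratic remainder is absorbed in a linear one; at larger distance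
the bound on `f` alone suffices. -/
lemma abs_sub_le (hf : AntitoneExpansion f p K) (x y : ι → ℝ) :
    |f y - f x| ≤ 2 * K * ‖y - x‖ := by
  have hK := hf.bound_nonneg
  rcases le_total ‖y - x‖ 1 with h | h
  · have h1 := hf.expansion x y
    have h2 := abs_sum_mul_le (v := y - x) (hf.sum_coeff_le x)
    simp only [Pi.sub_apply] at h2
    have h3 : K * ‖y - x‖ ^ 2 ≤ K * ‖y - x‖ := by
      refine mul_le_mul_of_nonneg_left ?_ hK
      nlinarith [norm_nonneg (y - x)]
    have h4 := abs_add_le (f y - f x - ∑ i, p x i * (y i - x i)) (∑ i, p x i * (y i - x i))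
    rw [sub_add_cancel] at h4
    linarith
  · have h4 := abs_sub (f y) (f x)
    have h5 := hf.abs_le x
    have h6 := hf.abs_le y
    nlinarith [mul_le_mul_of_nonneg_left h hK]

/-- Products of nonnegative functions with antitone expansions have antitone expansions. -/
lemma mul (hf : AntitoneExpansion f p K) (hg : AntitoneExpansion g q K)
    (hf0 : ∀ x, 0 ≤ f x) (hg0 : ∀ x, 0 ≤ g x) :
    AntitoneExpansion (fun x => f x * g x) (fun x i => f x * q x i + g x * p x i)
      (6 * K ^ 2) where
  measurable := hf.measurable.mul hg.measurable
  measurable_coeff := by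
    refine measurable_pi_lambda _ fun i => ?_
    exact (hf.measurable.mul ((measurable_pi_apply i).comp hg.measurable_coeff)).add
      (hg.measurable.mul ((measurable_pi_apply i).comp hf.measurable_coeff))
  abs_le x := by
    rw [abs_mul]
    nlinarith [hf.abs_le x, hg.abs_le x, abs_nonneg (f x), abs_nonneg (g x), hf.bound_nonneg]
  coeff_nonpos x i := by
    nlinarith [mul_nonneg (hf0 x) (neg_nonneg.2 (hg.coeff_nonpos x i)),
      mul_nonneg (hg0 x) (neg_nonneg.2 (hf.coeff_nonpos x i))]
  sum_coeff_le x := by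
    have hK := hf.bound_nonneg
    calc ∑ i, |f x * q x i + g x * p x i|
        ≤ ∑ i, (K * |q x i| + K * |p x i|) := by
          refine Finset.sum_le_sum fun i _ => (abs_add_le _ _).trans ?_
          rw [abs_mul, abs_mul]
          exact add_le_add (mul_le_mul_of_nonneg_right (hf.abs_le x) (abs_nonneg _))
            (mul_le_mul_of_nonneg_right (hg.abs_le x) (abs_nonneg _))
      _ = K * ∑ i, |q x i| + K * ∑ i, |p x i| := by
          rw [Finset.sum_add_distrib, Finset.mul_sum, Finset.mul_sum]
      _ ≤ K * K + K * K := add_le_add (mul_le_mul_of_nonneg_left (hg.sum_coeff_le x) hK)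
          (mul_le_mul_of_nonneg_left (hf.sum_coeff_le x) hK)
      _ ≤ 6 * K ^ 2 := by nlinarith
  expansion x y := by
    have hK := hf.bound_nonneg
    have hs : ∑ i, (f x * q x i + g x * p x i) * (y i - x i)
        = f x * ∑ i, q x i * (y i - x i) + g x * ∑ i, p x i * (y i - x i) := by
      rw [Finset.mul_sum, Finset.mul_sum, ← Finset.sum_add_distrib]
      exact Finset.sum_congr rfl fun i _ => by ring
    rw [hs]
    have e : f y * g y - f x * g x
        - (f x * ∑ i, q x i * (y i - x i) + g x * ∑ i, p x i * (y i - x i))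
        = f x * (g y - g x - ∑ i, q x i * (y i - x i))
          + g x * (f y - f x - ∑ i, p x i * (y i - x i)) + (f y - f x) * (g y - g x) := by ring
    rw [e]
    refine (abs_add_three _ _ _).trans ?_
    rw [abs_mul, abs_mul, abs_mul]
    have h1 := mul_le_mul (hf.abs_le x) (hg.expansion x y) (abs_nonneg _) hK
    have h2 := mul_le_mul (hg.abs_le x) (hf.expansion x y) (abs_nonneg _) hK
    have h3 := mul_le_mul (hf.abs_sub_le x y) (hg.abs_sub_le x y) (abs_nonneg _) (by positivity)
    calc _ ≤ _ := add_le_add (add_le_add h1 h2) h3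
      _ = 6 * K ^ 2 * ‖y - x‖ ^ 2 := by ring

end AntitoneExpansion

end Expansion

/-! ### One step of the Ornstein-Uhlenbeck chain. -/

section Pitt

variable {ι : Type*} [Fintype ι] {f g : (ι → ℝ) → ℝ} {p q : (ι → ℝ) → ι → ℝ} {K : ℝ}

/-- The displacement `(a-1)x + sy` has size `O(sM)`, and `1 - a ≤ s²`. Multiplying the two
expansions leaves the main term `s² U V`; the mixed terms stay explicit because they integrate to
zero, and all else is `O(s³)`. -/
lemma one_step_pointwise (hf : AntitoneExpansion f p K) (hg : AntitoneExpansion g q K) {a s : ℝ}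
    (ha0 : 0 ≤ a) (hs0 : 0 ≤ s) (has : a ^ 2 + s ^ 2 = 1) (x y : ι → ℝ) {M : ℝ}
    (hx : ‖x‖ ≤ M) (hy : ‖y‖ ≤ M) :
    - ((1 - a) * s) * ((∑ i, p x i * x i) * (∑ i, q x i * y i)
        + (∑ i, p x i * y i) * (∑ i, q x i * x i))
      + s ^ 2 * ((∑ i, p x i * y i) * (∑ i, q x i * y i))
      - s ^ 3 * (K ^ 2 * (16 * M ^ 3 + 16 * M ^ 4 + M ^ 2))
      ≤ (f (a • x + s • y) - f x) * (g (a • x + s • y) - g x) := by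
  have hK := hf.bound_nonneg
  have hM : 0 ≤ M := (norm_nonneg _).trans hx
  have hs1 : s ≤ 1 := by nlinarith
  have ha1 : a ≤ 1 := by nlinarith
  have has' : 1 - a ≤ s ^ 2 := by nlinarith
  have hs2 : s ^ 2 ≤ s := by nlinarith
  set A := ∑ i, p x i * x i
  set B := ∑ i, q x i * x i
  set U := ∑ i, p x i * y i
  set V := ∑ i, q x i * y i
  have hA : |A| ≤ K * M := (abs_sum_mul_le (hf.sum_coeff_le x)).trans (by gcongr)
  have hB : |B| ≤ K * M := (abs_sum_mul_le (hg.sum_coeff_le x)).trans (by gcongr)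
  have hδ : ‖a • x + s • y - x‖ ≤ 2 * s * M := by
    have h1 : a • x + s • y - x = (a - 1) • x + s • y := by module
    rw [h1]
    refine (norm_add_le _ _).trans ?_
    rw [norm_smul, norm_smul, Real.norm_of_nonneg hs0, Real.norm_eq_abs, abs_sub_comm,
      abs_of_nonneg (by linarith)]
    calc (1 - a) * ‖x‖ + s * ‖y‖ ≤ s * M + s * M := by
          gcongr
          linarith
      _ = 2 * s * M := by ring
  set δ := ‖a • x + s • y - x‖ with hδdef
  have hδ0 : 0 ≤ δ := norm_nonneg _
  have lin : ∀ r : ι → ℝ, ∑ i, r i * ((a • x + s • y) i - x i)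
      = (a - 1) * ∑ i, r i * x i + s * ∑ i, r i * y i := by
    intro r
    rw [Finset.mul_sum, Finset.mul_sum, ← Finset.sum_add_distrib]
    exact Finset.sum_congr rfl fun i _ => by simp; ring
  have hl : |(a - 1) * A + s * U| ≤ K * δ := by
    rw [← lin]; exact abs_sum_mul_le (v := a • x + s • y - x) (hf.sum_coeff_le x)
  have hm : |(a - 1) * B + s * V| ≤ K * δ := by
    rw [← lin]; exact abs_sum_mul_le (v := a • x + s • y - x) (hg.sum_coeff_le x)
  have hR := hf.expansion x (a • x + s • y)
  have hQ := hg.expansion x (a • x + s • y)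
  rw [lin] at hR hQ
  set l := (a - 1) * A + s * U with hldef
  set m := (a - 1) * B + s * V with hmdef
  set F := f (a • x + s • y) - f x
  set G := g (a • x + s • y) - g x
  have e : F * G = l * m + (l * (G - m) + (F - l) * m + (F - l) * (G - m)) := by ring
  have b1 : |l * (G - m)| ≤ K * δ * (K * δ ^ 2) := by
    rw [abs_mul]; exact mul_le_mul hl hQ (abs_nonneg _) (by positivity)
  have b2 : |(F - l) * m| ≤ K * δ ^ 2 * (K * δ) := by
    rw [abs_mul]; exact mul_le_mul hR hm (abs_nonneg _) (by positivity)
  have b3 : |(F - l) * (G - m)| ≤ K * δ ^ 2 * (K * δ ^ 2) := by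
    rw [abs_mul]; exact mul_le_mul hR hQ (abs_nonneg _) (by positivity)
  have b4 : K ^ 2 * (2 * δ ^ 3 + δ ^ 4) ≤ s ^ 3 * (K ^ 2 * (16 * M ^ 3 + 16 * M ^ 4)) := by
    have h3 : δ ^ 3 ≤ (2 * s * M) ^ 3 := by gcongr
    have h4 : δ ^ 4 ≤ (2 * s * M) ^ 4 := by gcongr
    have h5 : (2 * s * M) ^ 4 ≤ s ^ 3 * (16 * M ^ 4) := by
      have : (2 * s * M) ^ 4 = s * (s ^ 3 * (16 * M ^ 4)) := by ring
      rw [this]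
      exact mul_le_of_le_one_left (by positivity) hs1
    calc K ^ 2 * (2 * δ ^ 3 + δ ^ 4) ≤ K ^ 2 * (2 * (2 * s * M) ^ 3 + s ^ 3 * (16 * M ^ 4)) := by
          gcongr; linarith
      _ = _ := by ring
  have b5 : -(s ^ 3 * (K ^ 2 * M ^ 2)) ≤ (1 - a) ^ 2 * (A * B) := by
    have h1 : |(1 - a) ^ 2 * (A * B)| ≤ s ^ 3 * (K ^ 2 * M ^ 2) := by
      rw [abs_mul, abs_mul, abs_of_nonneg (sq_nonneg (1 - a))]
      have h2 : (1 - a) ^ 2 ≤ s ^ 3 := by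
        have : (1 - a) * (1 - a) ≤ s ^ 2 * s := mul_le_mul has' (by linarith) (by linarith)
          (by positivity)
        nlinarith
      calc (1 - a) ^ 2 * (|A| * |B|) ≤ s ^ 3 * ((K * M) * (K * M)) := by gcongr
        _ = _ := by ring
    exact (abs_le.1 h1).1
  have b1' := (abs_le.1 b1).1
  have b2' := (abs_le.1 b2).1
  have b3' := (abs_le.1 b3).1
  have e2 : l * m = (1 - a) ^ 2 * (A * B) - ((1 - a) * s) * (A * V + U * B) + s ^ 2 * (U * V) := by
    rw [hldef, hmdef]; ring
  have e3 : K * δ * (K * δ ^ 2) + K * δ ^ 2 * (K * δ) + K * δ ^ 2 * (K * δ ^ 2)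
      = K ^ 2 * (2 * δ ^ 3 + δ ^ 4) := by ring
  have e4 : s ^ 3 * (K ^ 2 * (16 * M ^ 3 + 16 * M ^ 4 + M ^ 2))
      = s ^ 3 * (K ^ 2 * (16 * M ^ 3 + 16 * M ^ 4)) + s ^ 3 * (K ^ 2 * M ^ 2) := by ring
  rw [e, e2, e4]
  linarith

variable {μ : Measure (ι → ℝ)} [IsGaussian μ]

/-- The Ornstein-Uhlenbeck kernel preserves functions with antitone expansions. -/
lemma AntitoneExpansion.ornsteinUhlenbeck (hg : AntitoneExpansion g q K) {a : ℝ} (s : ℝ)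
    (ha0 : 0 ≤ a) (ha1 : a ≤ 1) :
    AntitoneExpansion (fun x => ∫ y, g (a • x + s • y) ∂μ)
      (fun x i => ∫ y, a * q (a • x + s • y) i ∂μ) K := by
  have hK := hg.bound_nonneg
  have hgm := hg.measurable
  have hqm : ∀ i, Measurable fun x => q x i := fun i =>
    (measurable_pi_apply i).comp hg.measurable_coeff
  have hqK : ∀ x i, |q x i| ≤ K := fun x i =>
    (Finset.single_le_sum (f := fun i => |q x i|) (fun _ _ => abs_nonneg _)
      (Finset.mem_univ i)).trans (hg.sum_coeff_le x)
  have hgi : ∀ x, Integrable (fun y => g (a • x + s • y)) μ := fun x =>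
    Integrable.of_bound
      (hgm.comp (by fun_prop : Measurable fun y : ι → ℝ => a • x + s • y)).aestronglyMeasurable
      K (ae_of_all _ fun y => by simpa using hg.abs_le _)
  have hqi : ∀ x i, Integrable (fun y => a * q (a • x + s • y) i) μ := fun x i =>
    (Integrable.of_bound (C := K)
      (((hqm i).comp (by fun_prop : Measurable fun y : ι → ℝ => a • x + s • y)).aestronglyMeasurable)
      (ae_of_all _ fun y => by simpa using hqK _ i)).const_mul a
  refine ⟨?_, ?_, ?_, ?_, ?_, ?_⟩
  · exact (StronglyMeasurable.integral_prod_right (f := fun x y => g (a • x + s • y))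
      (by
        apply Measurable.stronglyMeasurable
        exact hgm.comp (by fun_prop))).measurable
  · refine measurable_pi_lambda _ fun i => ?_
    exact (StronglyMeasurable.integral_prod_right (f := fun x y => a * q (a • x + s • y) i)
      (by
        apply Measurable.stronglyMeasurable
        exact ((hqm i).comp (by fun_prop :
          Measurable fun z : (ι → ℝ) × (ι → ℝ) => a • z.1 + s • z.2)).const_mul a)).measurable
  · intro x
    have := norm_integral_le_of_norm_le_const (μ := μ) (f := fun y => g (a • x + s • y)) (C := K)
      (ae_of_all _ fun y => by simpa using hg.abs_le _)
    simpa using this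
  · exact fun x i => integral_nonpos fun y => mul_nonpos_of_nonneg_of_nonpos ha0
      (hg.coeff_nonpos _ _)
  · intro x
    calc ∑ i, |∫ y, a * q (a • x + s • y) i ∂μ| ≤ ∑ i, ∫ y, |a * q (a • x + s • y) i| ∂μ :=
          Finset.sum_le_sum fun i _ => abs_integral_le_integral_abs
      _ = ∫ y, ∑ i, |a * q (a • x + s • y) i| ∂μ :=
          (integral_finsetSum _ fun i _ => (hqi x i).abs).symm
      _ ≤ ∫ y, K ∂μ := by
          refine integral_mono (integrable_finsetSum _ fun i _ => (hqi x i).abs)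
            (integrable_const _) fun y => ?_
          simp only [abs_mul, ← Finset.mul_sum, abs_of_nonneg ha0]
          exact (mul_le_of_le_one_left (Finset.sum_nonneg fun _ _ => abs_nonneg _) ha1).trans
            (hg.sum_coeff_le _)
      _ = K := by simp
  · intro x y
    have e : (∫ z, g (a • y + s • z) ∂μ) - (∫ z, g (a • x + s • z) ∂μ)
        - ∑ i, (∫ z, a * q (a • x + s • z) i ∂μ) * (y i - x i)
        = ∫ z, (g (a • y + s • z) - g (a • x + s • z)
          - ∑ i, q (a • x + s • z) i * ((a • y + s • z) i - (a • x + s • z) i)) ∂μ := by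
      have h1 : ∀ z, ∑ i, q (a • x + s • z) i * ((a • y + s • z) i - (a • x + s • z) i)
          = ∑ i, a * q (a • x + s • z) i * (y i - x i) := fun z =>
        Finset.sum_congr rfl fun i _ => by simp; ring
      simp_rw [h1]
      rw [integral_sub (by exact (hgi y).sub (hgi x))
        (by exact integrable_finsetSum _ fun i _ => (hqi x i).mul_const _), integral_sub (hgi y) (hgi x),
        integral_finsetSum _ fun i _ => (hqi x i).mul_const _]
      simp_rw [integral_mul_const]
    -- The displacement shrinks by the factor `a ≤ 1`, so the constant remains `K`. The error per
    -- step is therefore uniform along the whole chain.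
    rw [e]
    have h2 := norm_integral_le_of_norm_le_const (μ := μ) (C := K * ‖y - x‖ ^ 2)
      (f := fun z => (g (a • y + s • z) - g (a • x + s • z)
          - ∑ i, q (a • x + s • z) i * ((a • y + s • z) i - (a • x + s • z) i)))
      (ae_of_all _ fun z => by
        refine (hg.expansion _ _).trans (mul_le_mul_of_nonneg_left ?_ hK)
        have h3 : a • y + s • z - (a • x + s • z) = a • (y - x) := by module
        rw [h3, norm_smul, Real.norm_of_nonneg ha0]
        gcongr
        exact mul_le_of_le_one_left (norm_nonneg _) ha1)
    simpa using h2

/-- Polynomially bounded functions are integrable against Gaussian measures. -/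
lemma integrable_of_le_norm_pow {E : Type*} [NormedAddCommGroup E] [NormedSpace ℝ E]
    [MeasurableSpace E] [BorelSpace E] [CompleteSpace E] [SecondCountableTopology E]
    {ν : Measure E} [IsGaussian ν] {h : E → ℝ} (hh : Measurable h) (C : ℝ) (n : ℕ)
    (hb : ∀ z, |h z| ≤ C * ‖z‖ ^ n) : Integrable h ν := by
  have hi : Integrable (fun z => C * ‖z‖ ^ n) ν := by
    refine Integrable.const_mul ?_ C
    rcases eq_or_ne n 0 with rfl | hn
    · simp
    · exact (IsGaussian.memLp_id ν n (by simp)).integrable_norm_pow hn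
  exact hi.mono' hh.aestronglyMeasurable (ae_of_all _ hb)

/-- The pair `(x, ax + sy)` is exchangeable: the reflection is a measure preserving involution that
swaps its two members. -/
lemma integral_mul_reflection_comm (hμ : μ[id] = 0) {a s : ℝ} (has : a ^ 2 + s ^ 2 = 1)
    (hf : Measurable f) (hg : Measurable g) :
    ∫ z, f (a • z.1 + s • z.2) * g z.1 ∂μ.prod μ
      = ∫ z, f z.1 * g (a • z.1 + s • z.2) ∂μ.prod μ := by
  rw [← integral_comp_reflection hμ has (h := fun z => f z.1 * g (a • z.1 + s • z.2)) (by fun_prop)]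
  congr 1
  funext z
  congr 2
  have h : a • (a • z.1 + s • z.2) + s • (s • z.1 - a • z.2) = (a ^ 2 + s ^ 2) • z.1 := by module
  rw [h, has, one_smul]

/-- The Dirichlet form identity for the exchangeable pair `(x, a x + s y)`. -/
lemma two_mul_integral_sub (hμ : μ[id] = 0) {a s : ℝ} (has : a ^ 2 + s ^ 2 = 1)
    (hf : Measurable f) (hg : Measurable g) (hfK : ∀ x, |f x| ≤ K) (hgK : ∀ x, |g x| ≤ K) :
    ∫ z, (f (a • z.1 + s • z.2) - f z.1) * (g (a • z.1 + s • z.2) - g z.1) ∂μ.prod μ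
      = 2 * (∫ x, f x * g x ∂μ - ∫ z, f z.1 * g (a • z.1 + s • z.2) ∂μ.prod μ) := by
  have hK : 0 ≤ K := (abs_nonneg _).trans (hfK 0)
  have hi : ∀ u v : (ι → ℝ) × (ι → ℝ) → (ι → ℝ), Measurable u → Measurable v →
      Integrable (fun z => f (u z) * g (v z)) (μ.prod μ) := fun u v hu hv =>
    Integrable.of_bound ((hf.comp hu).mul (hg.comp hv)).aestronglyMeasurable (K * K)
      (ae_of_all _ fun z => by
        rw [Real.norm_eq_abs, abs_mul]
        exact mul_le_mul (hfK _) (hgK _) (abs_nonneg _) hK)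
  have m1 : Measurable fun z : (ι → ℝ) × (ι → ℝ) => a • z.1 + s • z.2 := by fun_prop
  have h1 : ∫ z, f (a • z.1 + s • z.2) * g (a • z.1 + s • z.2) ∂μ.prod μ = ∫ x, f x * g x ∂μ := by
    rw [integral_linear_combination hμ (γ := 1) (f := fun x => f x * g x) (by simpa using has)
      (by fun_prop)]
    simp
  have h2 : ∫ z, f z.1 * g z.1 ∂μ.prod μ = ∫ x, f x * g x ∂μ := by
    simpa using integral_fun_fst (μ := μ) (ν := μ) (fun x => f x * g x)
  have h3 := integral_mul_reflection_comm hμ has hf hg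
  have e : ∀ z : (ι → ℝ) × (ι → ℝ),
      (f (a • z.1 + s • z.2) - f z.1) * (g (a • z.1 + s • z.2) - g z.1)
      = (f (a • z.1 + s • z.2) * g (a • z.1 + s • z.2) + f z.1 * g z.1)
        - (f (a • z.1 + s • z.2) * g z.1 + f z.1 * g (a • z.1 + s • z.2)) := fun z => by ring
  simp_rw [e]
  rw [integral_sub (by exact (hi _ _ m1 m1).add (hi _ _ measurable_fst measurable_fst))
    (by exact (hi _ _ m1 measurable_fst).add (hi _ _ measurable_fst m1)),
    integral_add (hi _ _ m1 m1) (hi _ _ measurable_fst measurable_fst),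
    integral_add (hi _ _ m1 measurable_fst) (hi _ _ measurable_fst m1), h1, h2, h3]
  ring

/-- One step of the Ornstein-Uhlenbeck chain nearly decreases the correlation of two functions with
antitone expansions. -/
lemma exists_one_step_bound (hμ : μ[id] = 0) (hcov : ∀ i j, 0 ≤ ∫ x, x i * x j ∂μ) (K : ℝ) :
    ∃ C : ℝ, 0 ≤ C ∧ ∀ (f g : (ι → ℝ) → ℝ) (p q : (ι → ℝ) → ι → ℝ),
      AntitoneExpansion f p K → AntitoneExpansion g q K →
      ∀ a s : ℝ, 0 ≤ a → 0 ≤ s → a ^ 2 + s ^ 2 = 1 →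
      ∫ z, f z.1 * g (a • z.1 + s • z.2) ∂μ.prod μ - C * s ^ 3 ≤ ∫ x, f x * g x ∂μ := by
  have hmom : ∀ n : ℕ, Integrable (fun z : (ι → ℝ) × (ι → ℝ) => ‖z‖ ^ n) (μ.prod μ) := fun n =>
    integrable_of_le_norm_pow (by fun_prop) 1 n fun z => by
      rw [one_mul, abs_of_nonneg (by positivity)]
  -- The pointwise error with `M = ‖z‖`, integrated. It depends only on `K` and `μ`; the half in `D
  -- / 2` comes from the factor `2` in the Dirichlet form identity.
  set D := ∫ z : (ι → ℝ) × (ι → ℝ), K ^ 2 * (16 * ‖z‖ ^ 3 + 16 * ‖z‖ ^ 4 + ‖z‖ ^ 2) ∂μ.prod μ with hD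
  have hDi : Integrable (fun z : (ι → ℝ) × (ι → ℝ) =>
      K ^ 2 * (16 * ‖z‖ ^ 3 + 16 * ‖z‖ ^ 4 + ‖z‖ ^ 2)) (μ.prod μ) :=
    ((((hmom 3).const_mul 16).add ((hmom 4).const_mul 16)).add (hmom 2)).const_mul _
  refine ⟨D / 2, ?_, ?_⟩
  · have : 0 ≤ D := integral_nonneg fun z => by positivity
    linarith
  intro f g p q hf hg a s ha0 hs0 has
  have hK := hf.bound_nonneg
  have hpm : ∀ i, Measurable fun x => p x i := fun i =>
    (measurable_pi_apply i).comp hf.measurable_coeff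
  have hqm : ∀ i, Measurable fun x => q x i := fun i =>
    (measurable_pi_apply i).comp hg.measurable_coeff
  have hfK := hf.abs_le
  have hgK := hg.abs_le
  have hfm := hf.measurable
  have hgm := hg.measurable
  have hz1 : ∀ z : (ι → ℝ) × (ι → ℝ), ‖z.1‖ ≤ ‖z‖ := fun z => norm_fst_le z
  have hz2 : ∀ z : (ι → ℝ) × (ι → ℝ), ‖z.2‖ ≤ ‖z‖ := fun z => norm_snd_le z
  have hcoord : ∀ j, ∫ y : ι → ℝ, y j ∂μ = 0 := fun j => by
    have := IsGaussian.integral_dual (μ := μ) (ContinuousLinearMap.proj (R := ℝ) j)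
    simp only [id_eq] at hμ
    simpa [hμ] using this
  have bilin : ∀ {r t : (ι → ℝ) → ι → ℝ} {u v : (ι → ℝ) × (ι → ℝ) → ι → ℝ},
      Measurable r → Measurable t → Measurable u → Measurable v →
      (∀ x, ∑ i, |r x i| ≤ K) → (∀ x, ∑ i, |t x i| ≤ K) →
      (∀ z, ‖u z‖ ≤ ‖z‖) → (∀ z, ‖v z‖ ≤ ‖z‖) →
      Integrable (fun z => (∑ i, r z.1 i * u z i) * (∑ j, t z.1 j * v z j)) (μ.prod μ) := by
    intro r t u v hr ht hu hv hrK htK huz hvz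
    have hr' : ∀ i, Measurable fun x => r x i := fun i => (measurable_pi_apply i).comp hr
    have ht' : ∀ i, Measurable fun x => t x i := fun i => (measurable_pi_apply i).comp ht
    have hu' : ∀ i, Measurable fun x => u x i := fun i => (measurable_pi_apply i).comp hu
    have hv' : ∀ i, Measurable fun x => v x i := fun i => (measurable_pi_apply i).comp hv
    refine integrable_of_le_norm_pow (by fun_prop) (K ^ 2) 2 fun z => ?_
    rw [abs_mul]
    have h1 := (abs_sum_mul_le (v := u z) (hrK z.1)).trans
      (mul_le_mul_of_nonneg_left (huz z) hK)
    have h2 := (abs_sum_mul_le (v := v z) (htK z.1)).trans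
      (mul_le_mul_of_nonneg_left (hvz z) hK)
    calc _ ≤ (K * ‖z‖) * (K * ‖z‖) := mul_le_mul h1 h2 (abs_nonneg _) (by positivity)
      _ = _ := by ring
  -- These terms are linear in the second copy, which is centered and independent of the first.
  have mixed : ∀ {r t : (ι → ℝ) → ι → ℝ}, Measurable r → Measurable t →
      (∀ x, ∑ i, |r x i| ≤ K) → (∀ x, ∑ i, |t x i| ≤ K) →
      ∫ z, (∑ i, r z.1 i * z.1 i) * (∑ j, t z.1 j * z.2 j) ∂μ.prod μ = 0 := by
    intro r t hr ht hrK htK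
    have hr' : ∀ i, Measurable fun x => r x i := fun i => (measurable_pi_apply i).comp hr
    have ht' : ∀ i, Measurable fun x => t x i := fun i => (measurable_pi_apply i).comp ht
    have e : ∀ z : (ι → ℝ) × (ι → ℝ), (∑ i, r z.1 i * z.1 i) * (∑ j, t z.1 j * z.2 j)
        = ∑ j, ((∑ i, r z.1 i * z.1 i) * t z.1 j) * z.2 j := fun z => by
      rw [Finset.mul_sum]
      exact Finset.sum_congr rfl fun j _ => by ring
    simp_rw [e]
    rw [integral_finsetSum]
    · refine Finset.sum_eq_zero fun j _ => ?_
      rw [integral_prod_mul (fun x => (∑ i, r x i * x i) * t x j) (fun y : ι → ℝ => y j), hcoord, mul_zero]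
    · intro j _
      refine integrable_of_le_norm_pow (by fun_prop) (K ^ 2) 2 fun z => ?_
      have h1 := (abs_sum_mul_le (v := z.1) (hrK z.1)).trans
        (mul_le_mul_of_nonneg_left (hz1 z) hK)
      have h2 : |t z.1 j| ≤ K := (Finset.single_le_sum (f := fun i => |t z.1 i|)
        (fun _ _ => abs_nonneg _) (Finset.mem_univ j)).trans (htK z.1)
      have h3 : |z.2 j| ≤ ‖z‖ := (norm_le_pi_norm z.2 j).trans (hz2 z)
      rw [abs_mul, abs_mul]
      calc _ ≤ (K * ‖z‖) * K * ‖z‖ := by gcongr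
        _ = _ := by ring
  -- The integral is the sum over `i, j` of `E[p i * q j]` times the covariance of coordinates `i`
  -- and `j`. Each summand is nonnegative since the coefficients are nonpositive; nonnegative
  -- correlation enters here.
  have main : 0 ≤ ∫ z, (∑ i, p z.1 i * z.2 i) * (∑ j, q z.1 j * z.2 j) ∂μ.prod μ := by
    have e : ∀ z : (ι → ℝ) × (ι → ℝ), (∑ i, p z.1 i * z.2 i) * (∑ j, q z.1 j * z.2 j)
        = ∑ i, ∑ j, (p z.1 i * q z.1 j) * (z.2 i * z.2 j) := fun z => by
      rw [Finset.sum_mul_sum]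
      exact Finset.sum_congr rfl fun i _ => Finset.sum_congr rfl fun j _ => by ring
    have hint : ∀ i j, Integrable (fun z : (ι → ℝ) × (ι → ℝ) =>
        (p z.1 i * q z.1 j) * (z.2 i * z.2 j)) (μ.prod μ) := by
      intro i j
      refine integrable_of_le_norm_pow (by fun_prop) (K ^ 2) 2 fun z => ?_
      have h1 : |p z.1 i| ≤ K := (Finset.single_le_sum (f := fun i => |p z.1 i|)
        (fun _ _ => abs_nonneg _) (Finset.mem_univ i)).trans (hf.sum_coeff_le z.1)
      have h2 : |q z.1 j| ≤ K := (Finset.single_le_sum (f := fun i => |q z.1 i|)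
        (fun _ _ => abs_nonneg _) (Finset.mem_univ j)).trans (hg.sum_coeff_le z.1)
      have h3 : ∀ j, |z.2 j| ≤ ‖z‖ := fun j => (norm_le_pi_norm z.2 j).trans (hz2 z)
      rw [abs_mul, abs_mul, abs_mul]
      calc _ ≤ K * K * (‖z‖ * ‖z‖) := by
            gcongr
            · exact h3 i
            · exact h3 j
        _ = _ := by ring
    simp_rw [e]
    rw [integral_finsetSum _ fun i _ => integrable_finsetSum _ fun j _ => hint i j]
    refine Finset.sum_nonneg fun i _ => ?_
    rw [integral_finsetSum _ fun j _ => hint i j]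
    refine Finset.sum_nonneg fun j _ => ?_
    rw [integral_prod_mul (fun x => p x i * q x j) (fun y : ι → ℝ => y i * y j)]
    exact mul_nonneg (integral_nonneg fun x =>
      mul_nonneg_of_nonpos_of_nonpos (hf.coeff_nonpos x i) (hg.coeff_nonpos x j)) (hcov i j)
  have i1 := bilin (u := Prod.fst) (v := Prod.snd) hf.measurable_coeff hg.measurable_coeff
    measurable_fst measurable_snd hf.sum_coeff_le hg.sum_coeff_le hz1 hz2
  have i2 := bilin (u := Prod.snd) (v := Prod.fst) hf.measurable_coeff hg.measurable_coeff
    measurable_snd measurable_fst hf.sum_coeff_le hg.sum_coeff_le hz2 hz1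
  have i3 := bilin (u := Prod.snd) (v := Prod.snd) hf.measurable_coeff hg.measurable_coeff
    measurable_snd measurable_snd hf.sum_coeff_le hg.sum_coeff_le hz2 hz2
  have m1 := mixed hf.measurable_coeff hg.measurable_coeff hf.sum_coeff_le hg.sum_coeff_le
  have m2 : ∫ z, (∑ i, p z.1 i * z.2 i) * (∑ j, q z.1 j * z.1 j) ∂μ.prod μ = 0 := by
    rw [← mixed hg.measurable_coeff hf.measurable_coeff hg.sum_coeff_le hf.sum_coeff_le]
    congr 1
    funext z
    ring
  have j1 := (i1.add i2).const_mul (-((1 - a) * s))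
  have j2 := i3.const_mul (s ^ 2)
  have j3 := hDi.const_mul (s ^ 3)
  have key := integral_mono ((j1.add j2).sub j3)
    (g := fun z => (f (a • z.1 + s • z.2) - f z.1) * (g (a • z.1 + s • z.2) - g z.1))
    (Integrable.of_bound (by fun_prop) (2 * K * (2 * K)) (ae_of_all _ fun z => by
        rw [Real.norm_eq_abs, abs_mul]
        have h1 := (abs_sub (f (a • z.1 + s • z.2)) (f z.1)).trans (add_le_add (hfK _) (hfK _))
        have h2 := (abs_sub (g (a • z.1 + s • z.2)) (g z.1)).trans (add_le_add (hgK _) (hgK _))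
        rw [two_mul]
        exact mul_le_mul h1 h2 (abs_nonneg _) (by positivity)))
    (fun z => one_step_pointwise hf hg ha0 hs0 has z.1 z.2 (hz1 z) (hz2 z))
  rw [two_mul_integral_sub hμ has hfm hgm hfK hgK] at key
  simp only [Pi.add_apply, Pi.sub_apply] at key
  rw [integral_sub (by exact j1.add j2) (by exact j3), integral_add (by exact j1) (by exact j2),
    integral_const_mul, integral_const_mul, integral_const_mul,
    integral_add (by exact i1) (by exact i2), m1, m2, ← hD] at key
  nlinarith [mul_nonneg (sq_nonneg s) main]

end Pitt

/-! ### Iteration of the steps: association. -/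

section Association

variable {ι : Type*} [Fintype ι] {μ : Measure (ι → ℝ)} [IsGaussian μ]
  {f g : (ι → ℝ) → ℝ} {p q : (ι → ℝ) → ι → ℝ} {K : ℝ}

lemma integrable_mul_of_abs_le {α : Type*} [MeasurableSpace α] {ν : Measure α} [IsFiniteMeasure ν]
    {F G : α → ℝ} (hF : Measurable F) (hG : Measurable G) (hFK : ∀ x, |F x| ≤ K)
    (hGK : ∀ x, |G x| ≤ K) : Integrable (fun x => F x * G x) ν :=
  Integrable.of_bound (hF.mul hG).aestronglyMeasurable (K * K) (ae_of_all _ fun z => by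
    rw [Real.norm_eq_abs, abs_mul]
    exact mul_le_mul (hFK _) (hGK _) (abs_nonneg _) ((abs_nonneg _).trans (hFK z)))

/-- Composition rule for the Ornstein-Uhlenbeck kernels, tested against a function. -/
lemma integral_ornsteinUhlenbeck_comp (hμ : μ[id] = 0) (hf : Measurable f) (hg : Measurable g)
    (hfK : ∀ x, |f x| ≤ K) (hgK : ∀ x, |g x| ≤ K) {a b s t r : ℝ}
    (hr : (a * s) ^ 2 + t ^ 2 = r ^ 2) :
    ∫ z, f z.1 * (∫ w, g (a • (b • z.1 + s • z.2) + t • w) ∂μ) ∂μ.prod μ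
      = ∫ z, f z.1 * g ((a * b) • z.1 + r • z.2) ∂μ.prod μ := by
  have hQ : Measurable fun x : ι → ℝ => ∫ w, g (a • x + t • w) ∂μ :=
    (StronglyMeasurable.integral_prod_right (f := fun x w : ι → ℝ => g (a • x + t • w)) (by
      apply Measurable.stronglyMeasurable
      exact hg.comp (by fun_prop))).measurable
  have hQK : ∀ x : ι → ℝ, |∫ w, g (a • x + t • w) ∂μ| ≤ K := fun x => by
    have := norm_integral_le_of_norm_le_const (μ := μ) (f := fun w => g (a • x + t • w)) (C := K)
      (ae_of_all _ fun y => by simpa using hgK _)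
    simpa using this
  rw [integral_prod _ (integrable_mul_of_abs_le
      (F := fun z : (ι → ℝ) × (ι → ℝ) => f z.1)
      (G := fun z => ∫ w, g (a • (b • z.1 + s • z.2) + t • w) ∂μ)
      (by fun_prop)
      (hQ.comp (by fun_prop : Measurable fun z : (ι → ℝ) × (ι → ℝ) => b • z.1 + s • z.2))
      (fun _ => hfK _) (fun _ => hQK _)),
    integral_prod _ (integrable_mul_of_abs_le
      (F := fun z : (ι → ℝ) × (ι → ℝ) => f z.1)
      (G := fun z => g ((a * b) • z.1 + r • z.2)) (by fun_prop) (by fun_prop)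
      (fun _ => hfK _) (fun _ => hgK _))]
  congr 1
  funext x
  simp only
  rw [integral_const_mul, integral_const_mul]
  congr 1
  have h := integral_linear_combination hμ hr (f := fun v => g ((a * b) • x + v))
    (hg.comp (by fun_prop))
  rw [← h, integral_prod (fun z : (ι → ℝ) × (ι → ℝ) => g ((a * b) • x + ((a * s) • z.1 + t • z.2)))
    (Integrable.of_bound (C := K)
      (hg.comp (by fun_prop)).aestronglyMeasurable (ae_of_all _ fun z => hgK _))]
  congr 1
  funext y
  congr 1
  funext w
  congr 1
  module

/-- The far end of the interpolation, where the arguments of `f` and `g` decouple. Only the argument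
of `g` moves, so continuity is asked of `g` alone. -/
lemma tendsto_integral_ornsteinUhlenbeck (hf : Measurable f) (hg : Continuous g)
    (hfK : ∀ x, |f x| ≤ K) (hgK : ∀ x, |g x| ≤ K) {a s : ℕ → ℝ}
    (ha : Tendsto a atTop (𝓝 0)) (hs : Tendsto s atTop (𝓝 1)) :
    Tendsto (fun n => ∫ z, f z.1 * g (a n • z.1 + s n • z.2) ∂μ.prod μ) atTop
      (𝓝 ((∫ x, f x ∂μ) * ∫ x, g x ∂μ)) := by
  rw [← integral_prod_mul]
  refine tendsto_integral_of_dominated_convergence (fun _ => K * K) (fun n => ?_)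
    (integrable_const _) (fun n => ae_of_all _ fun z => ?_) (ae_of_all _ fun z => ?_)
  · exact ((hf.comp measurable_fst).mul (hg.measurable.comp (by fun_prop))).aestronglyMeasurable
  · rw [Real.norm_eq_abs, abs_mul]
    exact mul_le_mul (hfK _) (hgK _) (abs_nonneg _) ((abs_nonneg _).trans (hfK 0))
  · refine Tendsto.const_mul _ ((hg.tendsto _).comp ?_)
    have h := (ha.smul_const z.1).add (hs.smul_const z.2)
    simpa using h

/-- Pitt's theorem: nonnegatively correlated centered Gaussian variables are associated. -/
lemma integral_mul_integral_le (hμ : μ[id] = 0) (hcov : ∀ i j, 0 ≤ ∫ x, x i * x j ∂μ)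
    (hf : AntitoneExpansion f p K) (hg : AntitoneExpansion g q K) (hgc : Continuous g) :
    (∫ x, f x ∂μ) * ∫ x, g x ∂μ ≤ ∫ x, f x * g x ∂μ := by
  obtain ⟨C, hC0, hC⟩ := exists_one_step_bound hμ hcov K
  set φ : ℝ → ℝ := fun a => ∫ z, f z.1 * g (a • z.1 + √(1 - a ^ 2) • z.2) ∂μ.prod μ with hφ
  have hφ1 : φ 1 = ∫ x, f x * g x ∂μ := by
    simp only [hφ]
    simpa using integral_fun_fst (μ := μ) (ν := μ) (fun x => f x * g x)
  have sqr : ∀ a : ℝ, 0 ≤ a → a ≤ 1 → √(1 - a ^ 2) ^ 2 = 1 - a ^ 2 := fun a h0 h1 =>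
    Real.sq_sqrt (by nlinarith)
  -- The one-step bound is applied to `f` and the smoothed function `x ↦ E g(ax + √(1-a²) Y)`. The
  -- composition rule turns the left side into `φ (a * e)`.
  have step : ∀ a e : ℝ, 0 ≤ a → a ≤ 1 → 0 ≤ e → e ≤ 1 →
      φ (a * e) - C * √(1 - e ^ 2) ^ 3 ≤ φ a := by
    intro a e ha0 ha1 he0 he1
    have hgQ := hg.ornsteinUhlenbeck (μ := μ) (√(1 - a ^ 2)) ha0 ha1
    have h := hC f _ p _ hf hgQ e (√(1 - e ^ 2)) he0 (Real.sqrt_nonneg _)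
      (by rw [sqr e he0 he1]; ring)
    have hae : (a * √(1 - e ^ 2)) ^ 2 + √(1 - a ^ 2) ^ 2 = √(1 - (a * e) ^ 2) ^ 2 := by
      rw [mul_pow, sqr e he0 he1, sqr a ha0 ha1, sqr (a * e) (by positivity)
        (mul_le_one₀ ha1 he0 he1)]
      ring
    rw [integral_ornsteinUhlenbeck_comp hμ hf.measurable hg.measurable hf.abs_le hg.abs_le hae] at h
    refine h.trans (le_of_eq ?_)
    simp only [hφ]
    rw [integral_prod _ (integrable_mul_of_abs_le
      (F := fun z : (ι → ℝ) × (ι → ℝ) => f z.1)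
      (G := fun z => g (a • z.1 + √(1 - a ^ 2) • z.2)) (hf.measurable.comp measurable_fst)
      (hg.measurable.comp (by fun_prop)) (fun _ => hf.abs_le _) (fun _ => hg.abs_le _))]
    congr 1
    funext x
    simp only
    rw [integral_const_mul]
  have iter : ∀ e : ℝ, 0 ≤ e → e ≤ 1 → ∀ n : ℕ,
      φ (e ^ n) - n * (C * √(1 - e ^ 2) ^ 3) ≤ φ 1 := by
    intro e he0 he1 n
    induction n with
    | zero => simp
    | succ n ih =>
      have := step (e ^ n) e (by positivity) (pow_le_one₀ he0 he1) he0 he1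
      rw [← pow_succ] at this
      push_cast
      linarith
  -- Take `k ^ 8` steps with `e = exp(-1/k⁶)`. The total factor is `exp(-k²)`, which tends to zero,
  -- while `√(1 - e²) ≤ 2/k³` makes the total error at most `k⁸ · C · 8/k⁹ = 8C/k`.
  have bound : ∀ k : ℕ, 1 ≤ k → φ (Real.exp (-(k : ℝ) ^ 2)) - 8 * C * (1 / (k : ℝ)) ≤ φ 1 := by
    intro k hk
    have hk' : (0 : ℝ) < k := by exact_mod_cast hk
    set e := Real.exp (-(1 / (k : ℝ) ^ 6)) with he
    have he1 : e ≤ 1 := Real.exp_le_one_iff.2 (by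
      have : (0 : ℝ) < 1 / (k : ℝ) ^ 6 := by positivity
      linarith)
    have he0 : 0 ≤ e := (Real.exp_pos _).le
    have h := iter e he0 he1 (k ^ 8)
    have hen : e ^ (k ^ 8) = Real.exp (-(k : ℝ) ^ 2) := by
      rw [he, ← Real.exp_nat_mul]
      congr 1
      push_cast
      field_simp
    have hs : √(1 - e ^ 2) ≤ 2 / (k : ℝ) ^ 3 := by
      rw [Real.sqrt_le_left (by positivity)]
      have h1 := Real.add_one_le_exp (-(1 / (k : ℝ) ^ 6))
      rw [← he] at h1
      have h2 : 1 - e ^ 2 ≤ 2 * (1 - e) := by nlinarith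
      have h3 : (2 / (k : ℝ) ^ 3) ^ 2 = 4 * (1 / (k : ℝ) ^ 6) := by
        field_simp
        norm_num
      have h4 : 0 < 1 / (k : ℝ) ^ 6 := by positivity
      rw [h3]
      linarith
    have hs3 : ((k ^ 8 : ℕ) : ℝ) * (C * √(1 - e ^ 2) ^ 3) ≤ 8 * C * (1 / (k : ℝ)) := by
      calc ((k ^ 8 : ℕ) : ℝ) * (C * √(1 - e ^ 2) ^ 3)
          ≤ ((k ^ 8 : ℕ) : ℝ) * (C * (2 / (k : ℝ) ^ 3) ^ 3) := by gcongr
        _ = 8 * C * (1 / (k : ℝ)) := by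
          push_cast
          field_simp
          norm_num
    rw [hen] at h
    linarith
  have t0 : Tendsto (fun k : ℕ => Real.exp (-(k : ℝ) ^ 2)) atTop (𝓝 0) :=
    Real.tendsto_exp_neg_atTop_nhds_zero.comp
      ((tendsto_pow_atTop two_ne_zero).comp tendsto_natCast_atTop_atTop)
  have t1 : Tendsto (fun k : ℕ => √(1 - Real.exp (-(k : ℝ) ^ 2) ^ 2)) atTop (𝓝 1) := by
    have h1 : Tendsto (fun k : ℕ => 1 - Real.exp (-(k : ℝ) ^ 2) ^ 2) atTop (𝓝 (1 - 0 ^ 2)) :=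
      tendsto_const_nhds.sub (t0.pow 2)
    have h2 := (Real.continuous_sqrt.tendsto _).comp h1
    simpa [Function.comp_def] using h2
  have lim := (tendsto_integral_ornsteinUhlenbeck (μ := μ) hf.measurable hgc hf.abs_le hg.abs_le
    t0 t1).sub (tendsto_one_div_atTop_nhds_zero_nat.const_mul (8 * C))
  rw [mul_zero, sub_zero] at lim
  rw [← hφ1]
  exact le_of_tendsto lim (eventually_atTop.2 ⟨1, bound⟩)

end Association

/-! ### Smoothing of orthant indicators and Slepian's inequality. -/

section Orthant

open Real in
/-- The smooth transition function has a globally quadratic Taylor remainder. -/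
lemma exists_smoothTransition_bound : ∃ K : ℝ, (∀ x, 0 ≤ deriv smoothTransition x) ∧
    (∀ x, deriv smoothTransition x ≤ K) ∧
    ∀ x y, |smoothTransition y - smoothTransition x - deriv smoothTransition x * (y - x)|
      ≤ K * (y - x) ^ 2 := by
  have hsm : ContDiff ℝ 2 smoothTransition := smoothTransition.contDiff (n := 2)
  have hd1 : ContDiff ℝ 1 (deriv smoothTransition) :=
    ((contDiff_succ_iff_deriv (n := 1)).1 hsm).2.2
  have hd2 : Continuous (deriv (deriv smoothTransition)) :=
    ((contDiff_succ_iff_deriv (n := 0)).1 hd1).2.2.continuous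
  have hz : ∀ x, x < 0 ∨ 1 < x → deriv smoothTransition x = 0 := by
    rintro x (hx | hx)
    · have : smoothTransition =ᶠ[𝓝 x] fun _ => 0 := by
        filter_upwards [Iio_mem_nhds hx] with y hy
        exact smoothTransition.zero_of_nonpos (le_of_lt hy)
      rw [this.deriv_eq, deriv_const]
    · have : smoothTransition =ᶠ[𝓝 x] fun _ => 1 := by
        filter_upwards [Ioi_mem_nhds hx] with y hy
        exact smoothTransition.one_of_one_le (le_of_lt hy)
      rw [this.deriv_eq, deriv_const]
  have hc : HasCompactSupport (deriv smoothTransition) :=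
    HasCompactSupport.intro (isCompact_Icc (a := (0 : ℝ)) (b := 1)) fun x hx => by
      rw [mem_Icc, not_and_or, not_le, not_le] at hx
      exact hz x hx
  obtain ⟨K1, hK1⟩ := hc.exists_bound_of_continuous hd1.continuous
  obtain ⟨K2, hK2⟩ := hc.deriv.exists_bound_of_continuous hd2
  have hK1' : 0 ≤ K1 := (norm_nonneg _).trans (hK1 0)
  have hK2' : 0 ≤ K2 := (norm_nonneg _).trans (hK2 0)
  refine ⟨K1 + K2, fun x => smoothTransition.monotone.deriv_nonneg,
    fun x => (le_abs_self _).trans ((hK1 x).trans (by linarith)), fun x y => ?_⟩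
  have hL : ∀ z, |deriv smoothTransition z - deriv smoothTransition x| ≤ K2 * |z - x| := fun z =>
    Convex.norm_image_sub_le_of_norm_deriv_le (s := univ)
      (fun w _ => (hd1.differentiable one_ne_zero).differentiableAt) (fun w _ => hK2 w)
      convex_univ (mem_univ x) (mem_univ z)
  -- The derivative is Lipschitz by the mean value inequality; a second application, to
  -- `smoothTransition` minus its tangent slope times `z`, yields the quadratic remainder.
  have hdiff : ∀ z, HasDerivAt (fun z => smoothTransition z - deriv smoothTransition x * z)
      (deriv smoothTransition z - deriv smoothTransition x) z := fun z => by
    have h1 := ((hsm.differentiable two_ne_zero).differentiableAt (x := z)).hasDerivAt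
    have h2 := (hasDerivAt_id z).const_mul (deriv smoothTransition x)
    rw [mul_one] at h2
    exact h1.sub h2
  have h := Convex.norm_image_sub_le_of_norm_hasDerivWithin_le (s := uIcc x y)
    (C := K2 * |y - x|) (fun z _ => (hdiff z).hasDerivWithinAt)
    (fun z hz => (hL z).trans (mul_le_mul_of_nonneg_left (abs_sub_left_of_mem_uIcc hz) hK2'))
    (convex_uIcc x y) left_mem_uIcc right_mem_uIcc
  simp only [Real.norm_eq_abs] at h
  have e : smoothTransition y - smoothTransition x - deriv smoothTransition x * (y - x)
      = smoothTransition y - deriv smoothTransition x * y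
        - (smoothTransition x - deriv smoothTransition x * x) := by ring
  rw [e]
  refine h.trans ?_
  rw [mul_assoc, abs_mul_abs_self, ← sq]
  exact mul_le_mul_of_nonneg_right (by linarith) (sq_nonneg _)

variable {ι : Type*}

/-- A smooth decreasing approximation from below of the indicator of `x i < u` for all `i ∈ S`. -/
noncomputable def softOrthant (S : Finset ι) (u : ℝ) (n : ℕ) (x : ι → ℝ) : ℝ :=
  ∏ i ∈ S, Real.smoothTransition (n * (u - x i))

lemma softOrthant_nonneg (S : Finset ι) (u : ℝ) (n : ℕ) (x : ι → ℝ) : 0 ≤ softOrthant S u n x :=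
  Finset.prod_nonneg fun _ _ => Real.smoothTransition.nonneg _

lemma softOrthant_le_one (S : Finset ι) (u : ℝ) (n : ℕ) (x : ι → ℝ) : softOrthant S u n x ≤ 1 :=
  Finset.prod_le_one (fun _ _ => Real.smoothTransition.nonneg _)
    fun _ _ => Real.smoothTransition.le_one _

@[fun_prop]
lemma continuous_softOrthant (S : Finset ι) (u : ℝ) (n : ℕ) : Continuous (softOrthant S u n) := by
  unfold softOrthant
  exact continuous_finsetProd _ fun i _ => Real.smoothTransition.continuous.comp (by fun_prop)

/-- A factor is exactly `1` once `n (u - x i) ≥ 1`, and is `0` for every `n` when `x i ≥ u`. The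
limit is thus the indicator of the strict inequalities, boundary included. -/
lemma tendsto_softOrthant (S : Finset ι) (u : ℝ) (x : ι → ℝ) :
    Tendsto (fun n => softOrthant S u n x) atTop
      (𝓝 ({x : ι → ℝ | ∀ i ∈ S, x i < u}.indicator 1 x)) := by
  by_cases h : ∀ i ∈ S, x i < u
  · rw [indicator_of_mem (by exact h)]
    have : (1 : (ι → ℝ) → ℝ) x = ∏ i ∈ S, (1 : ℝ) := by simp
    rw [this]
    refine tendsto_finsetProd _ fun i hi => ?_
    obtain ⟨N, hN⟩ := exists_nat_gt (1 / (u - x i))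
    refine tendsto_const_nhds.congr' ?_
    filter_upwards [eventually_ge_atTop N] with n hn
    have h0 : 0 < u - x i := sub_pos.2 (h i hi)
    symm
    apply Real.smoothTransition.one_of_one_le
    rw [div_lt_iff₀ h0] at hN
    exact hN.le.trans (mul_le_mul_of_nonneg_right (by exact_mod_cast hn) h0.le)
  · rw [indicator_of_notMem (by exact h)]
    push Not at h
    obtain ⟨i, hi, hiu⟩ := h
    refine tendsto_const_nhds.congr fun n => ?_
    refine (Finset.prod_eq_zero hi (Real.smoothTransition.zero_of_nonpos ?_)).symm
    exact mul_nonpos_of_nonneg_of_nonpos (by positivity) (by linarith)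

variable [Fintype ι]

lemma exists_antitoneExpansion_softOrthant (S : Finset ι) (u : ℝ) (n : ℕ) :
    ∃ p K, AntitoneExpansion (softOrthant S u n) p K := by
  classical
  obtain ⟨K, h0, hK, hexp⟩ := exists_smoothTransition_bound
  have hK0 : 0 ≤ K := (h0 0).trans (hK 0)
  induction S using Finset.induction_on with
  | empty =>
    refine ⟨fun _ _ => 0, 1, ?_⟩
    have e : softOrthant (∅ : Finset ι) u n = fun _ => 1 := by
      funext x
      simp [softOrthant]
    rw [e]
    refine ⟨measurable_const, measurable_const, by simp, by simp, by simp, fun x y => ?_⟩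
    simp
  | insert i S hi ih =>
    obtain ⟨p, L, hp⟩ := ih
    -- The summands `1`, `n * K`, `n ^ 2 * K` bound the value, the coefficient and the remainder;
    -- the last two come from the chain rule with slope `-n`.
    have h1 : AntitoneExpansion (fun x : ι → ℝ => Real.smoothTransition (n * (u - x i)))
        (fun x => Pi.single i (-(n * deriv Real.smoothTransition (n * (u - x i)))))
        (1 + n * K + n ^ 2 * K) := by
      have hn : (0 : ℝ) ≤ n := by positivity
      have hm : Measurable fun x : ι → ℝ => -(n * deriv Real.smoothTransition (n * (u - x i))) :=
        (((measurable_deriv _).comp (by fun_prop)).const_mul _).neg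
      refine ⟨by exact (Real.smoothTransition.continuous.comp (by fun_prop)).measurable,
        ?_, ?_, ?_, ?_, ?_⟩
      · refine measurable_pi_lambda _ fun j => ?_
        by_cases hj : j = i
        · subst hj
          simpa using hm
        · simp [Pi.single_eq_of_ne hj]
      · intro x
        rw [abs_of_nonneg (Real.smoothTransition.nonneg _)]
        have := Real.smoothTransition.le_one (n * (u - x i))
        nlinarith [mul_nonneg hn hK0, mul_nonneg (sq_nonneg (n : ℝ)) hK0]
      · intro x j
        by_cases hj : j = i
        · subst hj
          have := mul_nonneg hn (h0 (n * (u - x j)))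
          simpa using this
        · simp [Pi.single_eq_of_ne hj]
      · intro x
        rw [Finset.sum_eq_single i (fun j _ hj => by simp [Pi.single_eq_of_ne hj]) (by simp)]
        rw [Pi.single_eq_same, abs_neg, abs_of_nonneg (mul_nonneg hn (h0 _))]
        have := mul_le_mul_of_nonneg_left (hK (n * (u - x i))) hn
        nlinarith [mul_nonneg (sq_nonneg (n : ℝ)) hK0]
      · intro x y
        rw [Finset.sum_eq_single i (fun j _ hj => by simp [Pi.single_eq_of_ne hj]) (by simp)]
        rw [Pi.single_eq_same]
        have h2 := hexp (n * (u - x i)) (n * (u - y i))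
        have e : deriv Real.smoothTransition (n * (u - x i)) * (n * (u - y i) - n * (u - x i))
            = -(n * deriv Real.smoothTransition (n * (u - x i))) * (y i - x i) := by ring
        rw [e] at h2
        refine h2.trans ?_
        have h3 : (y i - x i) ^ 2 ≤ ‖y - x‖ ^ 2 := by
          rw [← sq_abs]
          exact pow_le_pow_left₀ (abs_nonneg _) (norm_le_pi_norm (y - x) i) 2
        calc K * (n * (u - y i) - n * (u - x i)) ^ 2 = n ^ 2 * K * (y i - x i) ^ 2 := by ring
          _ ≤ n ^ 2 * K * ‖y - x‖ ^ 2 := by gcongr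
          _ ≤ (1 + n * K + n ^ 2 * K) * ‖y - x‖ ^ 2 := by
            gcongr
            nlinarith [mul_nonneg hn hK0]
    have h2 := (h1.mono (le_max_left _ L)).mul (hp.mono (le_max_right _ L))
      (fun x => Real.smoothTransition.nonneg _) (softOrthant_nonneg S u n)
    have e : softOrthant (insert i S) u n
        = fun x => Real.smoothTransition (n * (u - x i)) * softOrthant S u n x := by
      funext x
      simp [softOrthant, Finset.prod_insert hi]
    rw [e]
    exact ⟨_, _, h2⟩

/-- Slepian's inequality for lower orthants of nonnegatively correlated Gaussian vectors. -/
lemma measureReal_orthant_mul_le {μ : Measure (ι → ℝ)} [IsGaussian μ] (hμ : μ[id] = 0)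
    (hcov : ∀ i j, 0 ≤ ∫ x, x i * x j ∂μ) (S T : Finset ι) (u : ℝ) :
    μ.real {x | ∀ i ∈ S, x i < u} * μ.real {x | ∀ i ∈ T, x i < u}
      ≤ μ.real ({x | ∀ i ∈ S, x i < u} ∩ {x | ∀ i ∈ T, x i < u}) := by
  have hmeas : ∀ S : Finset ι, MeasurableSet {x : ι → ℝ | ∀ i ∈ S, x i < u} := fun S => by
    have : {x : ι → ℝ | ∀ i ∈ S, x i < u} = ⋂ i ∈ S, {x | x i < u} := by ext; simp
    rw [this]
    exact Finset.measurableSet_biInter _ fun i _ =>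
      measurableSet_lt (measurable_pi_apply i) measurable_const
  have lim : ∀ S : Finset ι, Tendsto (fun n => ∫ x, softOrthant S u n x ∂μ) atTop
      (𝓝 (μ.real {x | ∀ i ∈ S, x i < u})) := fun S => by
    rw [← integral_indicator_one (hmeas S)]
    refine tendsto_integral_of_dominated_convergence (fun _ => 1)
      (fun n => (continuous_softOrthant S u n).measurable.aestronglyMeasurable)
      (integrable_const _) (fun n => ae_of_all _ fun x => ?_)
      (ae_of_all _ fun x => tendsto_softOrthant S u x)
    rw [Real.norm_of_nonneg (softOrthant_nonneg _ _ _ _)]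
    exact softOrthant_le_one _ _ _ _
  have lim2 : Tendsto (fun n => ∫ x, softOrthant S u n x * softOrthant T u n x ∂μ) atTop
      (𝓝 (μ.real ({x | ∀ i ∈ S, x i < u} ∩ {x | ∀ i ∈ T, x i < u}))) := by
    rw [← integral_indicator_one ((hmeas S).inter (hmeas T)), inter_indicator_one]
    refine tendsto_integral_of_dominated_convergence (fun _ => 1)
      (fun n => ((continuous_softOrthant S u n).mul
        (continuous_softOrthant T u n)).measurable.aestronglyMeasurable)
      (integrable_const _) (fun n => ae_of_all _ fun x => ?_)
      (ae_of_all _ fun x => (tendsto_softOrthant S u x).mul (tendsto_softOrthant T u x))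
    rw [Real.norm_of_nonneg (mul_nonneg (softOrthant_nonneg _ _ _ _) (softOrthant_nonneg _ _ _ _))]
    exact mul_le_one₀ (softOrthant_le_one _ _ _ _) (softOrthant_nonneg _ _ _ _)
      (softOrthant_le_one _ _ _ _)
  refine le_of_tendsto_of_tendsto' ((lim S).mul (lim T)) lim2 fun n => ?_
  obtain ⟨p, K, hp⟩ := exists_antitoneExpansion_softOrthant S u n
  obtain ⟨q, L, hq⟩ := exists_antitoneExpansion_softOrthant T u n
  exact integral_mul_integral_le hμ hcov (hp.mono (le_max_left K L)) (hq.mono (le_max_right K L))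
    (continuous_softOrthant T u n)

end Orthant

/-! ### Subhomogeneous functions with two incommensurable scales. -/

section Subadditive

/-- The additive semigroup generated by two incommensurable reals is asymptotically
dense. -/
lemma exists_forall_ge_exists_natCast_combination {α β : ℝ} (hα : 0 < α)
    (h : Irrational (α / β)) {δ : ℝ} (hδ : 0 < δ) :
    ∃ M : ℝ, ∀ y, M ≤ y → ∃ a b : ℕ, y ≤ a * α + b * β ∧ a * α + b * β ≤ y + δ := by
  have hd := (dense_addSubgroupClosure_pair_iff (a := α) (b := β)).2 h
  -- Integer combinations are dense; the window starts at `k + 1`, not `k`, so that the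
  -- approximation overshoots any `t` in `[k δ/2, (k+1) δ/2)`, by at most `δ`.
  have hex : ∀ k : ℕ, ∃ m n : ℤ, (k + 1) * (δ / 2) < m * α + n * β ∧
      m * α + n * β < (k + 2) * (δ / 2) := fun k => by
    obtain ⟨x, hx, hx1, hx2⟩ := hd.exists_between
      (show ((k : ℝ) + 1) * (δ / 2) < (k + 2) * (δ / 2) by nlinarith)
    obtain ⟨m, n, rfl⟩ := AddSubgroup.mem_closure_pair.1 hx
    exact ⟨m, n, by simpa using hx1, by simpa using hx2⟩
  choose m n hmn1 hmn2 using hex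
  obtain ⟨N, hN⟩ := exists_nat_gt (α / (δ / 2))
  -- The remainder modulo `α` meets only the windows `k < N`, so one `Q` dominates all coefficients
  -- in use. Shifting by `Q α + Q β` makes them natural numbers.
  set Q : ℕ := ∑ k ∈ Finset.range N, ((m k).natAbs + (n k).natAbs) with hQ
  have hmQ : ∀ k < N, (m k).natAbs + (n k).natAbs ≤ Q := fun k hk =>
    Finset.single_le_sum (f := fun k => (m k).natAbs + (n k).natAbs) (fun _ _ => Nat.zero_le _)
      (Finset.mem_range.2 hk)
  refine ⟨Q * α + Q * β, fun y hy => ?_⟩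
  set w := y - (Q * α + Q * β) with hw
  have hw0 : 0 ≤ w := sub_nonneg.2 hy
  set j := ⌊w / α⌋₊ with hj
  have hj1 : j * α ≤ w := (le_div_iff₀ hα).1 (Nat.floor_le (by positivity))
  have hj2 : w < (j + 1) * α := (div_lt_iff₀ hα).1 (Nat.lt_floor_add_one _)
  set t := w - j * α with ht
  have ht0 : 0 ≤ t := sub_nonneg.2 hj1
  set k := ⌊t / (δ / 2)⌋₊ with hk
  have hk1 : k * (δ / 2) ≤ t := (le_div_iff₀ (by positivity)).1 (Nat.floor_le (by positivity))
  have hk2 : t < (k + 1) * (δ / 2) := (div_lt_iff₀ (by positivity)).1 (Nat.lt_floor_add_one _)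
  have hkN : k < N := by
    have : (k : ℝ) < N := by
      refine lt_of_le_of_lt ?_ hN
      rw [le_div_iff₀ (by positivity)]
      nlinarith
    exact_mod_cast this
  have hQk := hmQ k hkN
  refine ⟨(Q + j + m k).toNat, (Q + n k).toNat, ?_⟩
  have e1 : (((Q + j + m k).toNat : ℕ) : ℝ) = Q + j + m k := by
    have : (((Q + j + m k).toNat : ℕ) : ℤ) = Q + j + m k := Int.toNat_of_nonneg (by omega)
    exact_mod_cast congrArg (fun z : ℤ => (z : ℝ)) this
  have e2 : (((Q + n k).toNat : ℕ) : ℝ) = Q + n k := by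
    have : (((Q + n k).toNat : ℕ) : ℤ) = Q + n k := Int.toNat_of_nonneg (by omega)
    exact_mod_cast congrArg (fun z : ℤ => (z : ℝ)) this
  rw [e1, e2]
  have h1 := hmn1 k
  have h2 := hmn2 k
  constructor <;> nlinarith

variable {r₁ r₂ D : ℕ}

/-- A nondecreasing function that is subhomogeneous of degree `D` with respect to two
multiplicatively independent integers is asymptotically homogeneous. -/
lemma exists_tendsto_div_pow (hr₂ : 1 < r₂) (hr : r₂ < r₁)
    (hirr : Irrational (Real.log r₁ / Real.log r₂)) {L : ℝ → ℝ} (hL0 : ∀ T, 0 ≤ L T)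
    (hmono : ∀ T T', 0 < T → T < T' → L T ≤ L T')
    (h₁ : ∀ T, 0 < T → L T ≤ r₁ ^ D * L (T / r₁)) (h₂ : ∀ T, 0 < T → L T ≤ r₂ ^ D * L (T / r₂)) :
    ∃ θ : ℝ, 0 ≤ θ ∧ Tendsto (fun T => L T / T ^ D) atTop (𝓝 θ) := by
  have hr₁0 : (0 : ℝ) < r₁ := by exact_mod_cast (by omega : 0 < r₁)
  have hr₂0 : (0 : ℝ) < r₂ := by exact_mod_cast (by omega : 0 < r₂)
  have hα : 0 < Real.log r₁ := Real.log_pos (by exact_mod_cast (by omega : 1 < r₁))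
  have iter : ∀ r : ℝ, 0 < r → (∀ T, 0 < T → L T ≤ r ^ D * L (T / r)) →
      ∀ a : ℕ, ∀ T, 0 < T → L (r ^ a * T) ≤ (r ^ a) ^ D * L T := by
    intro r hr h a
    induction a with
    | zero => intro T _; simp
    | succ a ih =>
      intro T hT
      have h1 := h (r ^ (a + 1) * T) (by positivity)
      have e : r ^ (a + 1) * T / r = r ^ a * T := by
        field_simp
        ring
      rw [e] at h1
      calc _ ≤ _ := h1
        _ ≤ r ^ D * ((r ^ a) ^ D * L T) := by
          gcongr
          exact ih T hT
        _ = _ := by ring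
  have hrr : ∀ a b : ℕ, ∀ T, 0 < T →
      L ((r₁ : ℝ) ^ a * (r₂ : ℝ) ^ b * T) ≤ ((r₁ : ℝ) ^ a * (r₂ : ℝ) ^ b) ^ D * L T := by
    intro a b T hT
    have h1 := iter r₁ hr₁0 h₁ a ((r₂ : ℝ) ^ b * T) (by positivity)
    have h2 := iter r₂ hr₂0 h₂ b T hT
    rw [← mul_assoc] at h1
    calc _ ≤ _ := h1
      _ ≤ ((r₁ : ℝ) ^ a) ^ D * (((r₂ : ℝ) ^ b) ^ D * L T) := by gcongr
      _ = _ := by ring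
  have hmono' : ∀ T T', 0 < T → T ≤ T' → L T ≤ L T' := fun T T' hT h => by
    rcases h.eq_or_lt with rfl | h
    · rfl
    · exact hmono _ _ hT h
  have hbdd : BddBelow ((fun T => L T / T ^ D) '' Ioi 0) :=
    ⟨0, by rintro _ ⟨T, hT, rfl⟩; exact div_nonneg (hL0 T) (pow_nonneg (le_of_lt hT) _)⟩
  have hne : ((fun T => L T / T ^ D) '' Ioi 0).Nonempty := nonempty_Ioi.image _
  refine ⟨sInf ((fun T => L T / T ^ D) '' Ioi 0), Real.sInf_nonneg (by
    rintro _ ⟨T, hT, rfl⟩; exact div_nonneg (hL0 T) (pow_nonneg (le_of_lt hT) _)), ?_⟩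
  rw [tendsto_order]
  constructor
  · intro c hc
    filter_upwards [Ioi_mem_atTop 0] with T hT
    exact hc.trans_le (csInf_le hbdd ⟨T, hT, rfl⟩)
  · intro c hc
    -- For a nearly minimizing `S`, each large `T` admits `R = r₁ ^ a * r₂ ^ b` with `T ≤ R S ≤ T
    -- e^δ`. Monotonicity and subhomogeneity then bound `L T / T ^ D` by `e^(δD) L S / S ^ D`.
    obtain ⟨_, ⟨S, hS, rfl⟩, hSc⟩ := exists_lt_of_csInf_lt hne hc
    have hS0 : 0 < S := hS
    have hcont : Tendsto (fun δ : ℝ => Real.exp δ ^ D * (L S / S ^ D)) (𝓝[>] 0)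
        (𝓝 (L S / S ^ D)) := by
      have : Continuous fun δ : ℝ => Real.exp δ ^ D * (L S / S ^ D) := by fun_prop
      have h := (this.tendsto 0).mono_left (nhdsWithin_le_nhds (s := Ioi 0))
      simpa using h
    obtain ⟨δ, hδc, hδ0⟩ := ((hcont.eventually (gt_mem_nhds hSc)).and self_mem_nhdsWithin).exists
    obtain ⟨M, hM⟩ := exists_forall_ge_exists_natCast_combination hα hirr hδ0
    filter_upwards [Ioi_mem_atTop 0, eventually_ge_atTop (S * Real.exp M)] with T hT hTM
    have hT0 : 0 < T := hT
    obtain ⟨a, b, hab1, hab2⟩ := hM (Real.log (T / S)) (by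
      rw [Real.le_log_iff_exp_le (by positivity), le_div_iff₀ hS0]
      linarith)
    have hR : Real.exp (a * Real.log r₁ + b * Real.log r₂) = (r₁ : ℝ) ^ a * (r₂ : ℝ) ^ b := by
      rw [Real.exp_add, mul_comm (a : ℝ), mul_comm (b : ℝ), Real.exp_mul, Real.exp_mul,
        Real.exp_log hr₁0, Real.exp_log hr₂0, Real.rpow_natCast, Real.rpow_natCast]
    set R := (r₁ : ℝ) ^ a * (r₂ : ℝ) ^ b with hRdef
    have hR1 : T ≤ R * S := by
      have := Real.exp_le_exp.2 hab1
      rwa [hR, Real.exp_log (by positivity), div_le_iff₀ hS0] at this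
    have hR2 : R * S ≤ T * Real.exp δ := by
      have := Real.exp_le_exp.2 hab2
      rw [hR, Real.exp_add, Real.exp_log (by positivity), div_mul_eq_mul_div, le_div_iff₀ hS0]
        at this
      exact this
    refine lt_of_le_of_lt ?_ hδc
    have hLS := hL0 S
    calc L T / T ^ D ≤ R ^ D * L S / T ^ D := by
          gcongr
          exact (hmono' _ _ hT0 hR1).trans (hrr a b S hS0)
      _ = (R * S) ^ D * (L S / S ^ D) / T ^ D := by
          rw [mul_pow R]
          field_simp
      _ ≤ (T * Real.exp δ) ^ D * (L S / S ^ D) / T ^ D := by gcongr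
      _ = Real.exp δ ^ D * (L S / S ^ D) := by
          rw [mul_pow]
          field_simp

/-- The logarithmic asymptotics of a nonincreasing function with values in `[0, 1]` which is
supermultiplicative along two multiplicatively independent integers. -/
theorem exists_tendsto_neg_log_div_pow (hr₂ : 1 < r₂) (hr : r₂ < r₁)
    (hirr : Irrational (Real.log r₁ / Real.log r₂)) {p : ℝ → ℝ≥0∞} (hp1 : ∀ T, p T ≤ 1)
    (hanti : ∀ T T', 0 < T → T < T' → p T' ≤ p T)
    (h₁ : ∀ T, 0 < T → p (T / r₁) ^ (r₁ ^ D) ≤ p T)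
    (h₂ : ∀ T, 0 < T → p (T / r₂) ^ (r₂ ^ D) ≤ p T) :
    ∃ θ : EReal, 0 ≤ θ ∧
      Tendsto (fun T : ℝ => -ENNReal.log (p T) / ((T ^ D : ℝ) : EReal)) atTop (𝓝 θ) ∧
      (θ < ⊤ ↔ ∃ T : ℝ, 0 < T ∧ 0 < p T) := by
  by_cases hex : ∃ T : ℝ, 0 < T ∧ 0 < p T
  · obtain ⟨S, hS, hpS⟩ := hex
    have hr₁0 : (0 : ℝ) < r₁ := by exact_mod_cast (by omega : 0 < r₁)
    have hr₂0 : (0 : ℝ) < r₂ := by exact_mod_cast (by omega : 0 < r₂)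
    have hr₁1 : (1 : ℝ) < r₁ := by exact_mod_cast (by omega : 1 < r₁)
    have hiter : ∀ n : ℕ, 0 < p ((r₁ : ℝ) ^ n * S) := by
      intro n
      induction n with
      | zero => simpa using hpS
      | succ n ih =>
        have h := h₁ ((r₁ : ℝ) ^ (n + 1) * S) (by positivity)
        have e : (r₁ : ℝ) ^ (n + 1) * S / r₁ = (r₁ : ℝ) ^ n * S := by
          field_simp
          ring
        rw [e] at h
        exact lt_of_lt_of_le (ENNReal.pow_pos ih _) h
    have hpos : ∀ T, 0 < T → 0 < p T := by
      intro T hT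
      obtain ⟨n, hn⟩ := pow_unbounded_of_one_lt (T / S) hr₁1
      rw [div_lt_iff₀ hS] at hn
      exact lt_of_lt_of_le (hiter n) (hanti _ _ hT hn)
    have htop : ∀ T, p T ≠ ⊤ := fun T => ne_top_of_le_ne_top ENNReal.one_ne_top (hp1 T)
    have hpos' : ∀ T, 0 < T → 0 < (p T).toReal := fun T hT =>
      ENNReal.toReal_pos (hpos T hT).ne' (htop T)
    have hsup : ∀ r : ℕ, 0 < r → (∀ T, 0 < T → p (T / r) ^ (r ^ D) ≤ p T) → ∀ T, 0 < T →
        -Real.log (p T).toReal ≤ (r : ℝ) ^ D * -Real.log (p (T / r)).toReal := by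
      intro r hr h T hT
      have hr0 : (0 : ℝ) < r := by exact_mod_cast hr
      have h1 := ENNReal.toReal_mono (htop T) (h T hT)
      rw [ENNReal.toReal_pow] at h1
      have h2 := Real.log_le_log (pow_pos (hpos' (T / r) (by positivity)) _) h1
      rw [Real.log_pow] at h2
      push_cast at h2
      linarith
    obtain ⟨θ, hθ0, hθ⟩ := exists_tendsto_div_pow (D := D) hr₂ hr hirr
      (L := fun T => -Real.log (p T).toReal)
      (fun T => neg_nonneg.2 (Real.log_nonpos ENNReal.toReal_nonneg
        (by simpa using ENNReal.toReal_mono ENNReal.one_ne_top (hp1 T))))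
      (fun T T' hT hTT' => neg_le_neg (Real.log_le_log (hpos' T' (hT.trans hTT'))
        (ENNReal.toReal_mono (htop T) (hanti T T' hT hTT'))))
      (hsup r₁ (by omega) h₁) (hsup r₂ (by omega) h₂)
    refine ⟨θ, by exact_mod_cast hθ0, ?_, iff_of_true (EReal.coe_lt_top θ) ⟨S, hS, hpS⟩⟩
    refine ((continuous_coe_real_ereal.tendsto θ).comp hθ).congr' ?_
    filter_upwards [Ioi_mem_atTop 0] with T hT
    rw [ENNReal.log_pos_real (hpos T hT).ne' (htop T)]
    simp only [Function.comp, EReal.coe_div, EReal.coe_neg]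
  · refine ⟨⊤, le_top, ?_, iff_of_false (lt_irrefl _) hex⟩
    push Not at hex
    refine tendsto_const_nhds.congr' ?_
    filter_upwards [Ioi_mem_atTop 0] with T hT
    have hT0 : (0 : ℝ) < T ^ D := pow_pos hT D
    rw [le_antisymm (hex T hT) zero_le, ENNReal.log_zero, EReal.neg_bot,
      EReal.top_div_of_pos_ne_top (by exact_mod_cast hT0) (EReal.coe_ne_top _)]

end Subadditive

/-! ### Continuity of the covariance. -/

section Covariance

variable {Ω S : Type*} [MeasurableSpace Ω] {P : Measure Ω} {x : S → Ω → ℝ}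

/-- Recovers the second moment from the integral of a bounded function, so that dominated
convergence needs no moment bounds. -/
lemma integral_cos_of_hasGaussianLaw {Z : Ω → ℝ} (hZ : HasGaussianLaw Z P)
    (h0 : ∫ ω, Z ω ∂P = 0) : ∫ ω, Real.cos (Z ω) ∂P = Real.exp (-(∫ ω, Z ω ^ 2 ∂P) / 2) := by
  have := hZ.isProbabilityMeasure
  have hm := hZ.aemeasurable
  have h := hZ.charFun_map_eq 1
  rw [charFun_apply_real, integral_map hm (by fun_prop)] at h
  have hv : Var[Z; P] = ∫ ω, Z ω ^ 2 ∂P := by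
    rw [variance_eq_sub hZ.memLp_two, h0]
    simp
  have h1 : (fun ω => inner ℝ (1 : ℝ) (Z ω)) = Z := by funext ω; simp
  rw [h1, h0, hv] at h
  have hi : Integrable (fun ω => Complex.exp ((Z ω : ℂ) * Complex.I)) P :=
    Integrable.of_bound (C := 1) (by fun_prop)
      (ae_of_all _ fun ω => by rw [Complex.norm_exp_ofReal_mul_I])
  have h2 := congrArg Complex.re h
  simp only [Complex.ofReal_one, one_mul, Complex.ofReal_zero, zero_mul, zero_sub] at h2
  have h3 : (∫ ω, Complex.exp ((Z ω : ℂ) * Complex.I) ∂P).re = ∫ ω, Real.cos (Z ω) ∂P := by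
    rw [← RCLike.re_eq_complex_re, ← integral_re hi]
    simp [Complex.exp_ofReal_mul_I_re]
  rw [h3] at h2
  rw [h2, ← Complex.exp_ofReal_re]
  push_cast
  congr 2
  ring

variable [TopologicalSpace S] [FirstCountableTopology S]

/-- The covariance of a centered Gaussian process with continuous paths is continuous. -/
lemma continuous_integral_mul (hx : IsGaussianProcess x P) (h0 : ∀ s, ∫ ω, x s ω ∂P = 0)
    (hcont : ∀ᵐ ω ∂P, Continuous fun s => x s ω) :
    Continuous fun z : S × S => ∫ ω, x z.1 ω * x z.2 ω ∂P := by
  have := hx.isProbabilityMeasure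
  have hL : ∀ s, MemLp (x s) 2 P := fun s => (hx.hasGaussianLaw_eval s).memLp_two
  have hI : ∀ s, Integrable (x s) P := fun s => (hL s).integrable (by norm_num)
  have hm : ∀ s, AEMeasurable (x s) P := hx.aemeasurable
  have hadd : ∀ z : S × S, ∫ ω, (x z.1 ω + x z.2 ω) ^ 2 ∂P
      = -2 * Real.log (∫ ω, Real.cos (x z.1 ω + x z.2 ω) ∂P) := fun z => by
    rw [integral_cos_of_hasGaussianLaw hx.hasGaussianLaw_fun_add
      (by rw [integral_add (hI _) (hI _), h0, h0, add_zero]), Real.log_exp]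
    ring
  have hsub : ∀ z : S × S, ∫ ω, (x z.1 ω - x z.2 ω) ^ 2 ∂P
      = -2 * Real.log (∫ ω, Real.cos (x z.1 ω - x z.2 ω) ∂P) := fun z => by
    rw [integral_cos_of_hasGaussianLaw hx.hasGaussianLaw_fun_sub
      (by rw [integral_sub (hI _) (hI _), h0, h0, sub_zero]), Real.log_exp]
    ring
  have hpol : ∀ z : S × S, ∫ ω, x z.1 ω * x z.2 ω ∂P
      = ((∫ ω, (x z.1 ω + x z.2 ω) ^ 2 ∂P) - ∫ ω, (x z.1 ω - x z.2 ω) ^ 2 ∂P) / 4 := fun z => by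
    rw [← integral_sub (by exact ((hL z.1).add (hL z.2)).integrable_sq)
      (by exact ((hL z.1).sub (hL z.2)).integrable_sq),
      ← integral_div]
    congr 1
    funext ω
    ring
  simp_rw [hpol, hadd, hsub]
  have hpos1 : ∀ z : S × S, ∫ ω, Real.cos (x z.1 ω + x z.2 ω) ∂P ≠ 0 := fun z => by
    rw [integral_cos_of_hasGaussianLaw hx.hasGaussianLaw_fun_add
      (by rw [integral_add (hI _) (hI _), h0, h0, add_zero])]
    exact (Real.exp_pos _).ne'
  have hpos2 : ∀ z : S × S, ∫ ω, Real.cos (x z.1 ω - x z.2 ω) ∂P ≠ 0 := fun z => by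
    rw [integral_cos_of_hasGaussianLaw hx.hasGaussianLaw_fun_sub
      (by rw [integral_sub (hI _) (hI _), h0, h0, sub_zero])]
    exact (Real.exp_pos _).ne'
  have c1 : Continuous fun z : S × S => ∫ ω, Real.cos (x z.1 ω + x z.2 ω) ∂P := by
    refine continuous_of_dominated (bound := fun _ => 1) (fun z => ?_)
      (fun z => ae_of_all _ fun ω => Real.abs_cos_le_one _) (integrable_const _) ?_
    · exact (Real.measurable_cos.comp_aemeasurable ((hm _).add (hm _))).aestronglyMeasurable
    · filter_upwards [hcont] with ω hω
      exact Real.continuous_cos.comp ((hω.comp continuous_fst).add (hω.comp continuous_snd))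
  have c2 : Continuous fun z : S × S => ∫ ω, Real.cos (x z.1 ω - x z.2 ω) ∂P := by
    refine continuous_of_dominated (bound := fun _ => 1) (fun z => ?_)
      (fun z => ae_of_all _ fun ω => Real.abs_cos_le_one _) (integrable_const _) ?_
    · exact (Real.measurable_cos.comp_aemeasurable ((hm _).sub (hm _))).aestronglyMeasurable
    · filter_upwards [hcont] with ω hω
      exact Real.continuous_cos.comp ((hω.comp continuous_fst).sub (hω.comp continuous_snd))
  exact (((c1.log hpos1).const_mul (-2)).sub ((c2.log hpos2).const_mul (-2))).div_const 4

end Covariance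

/-! ### Absence of an atom for the supremum. -/

section Supremum

variable {Ω S : Type*} [MeasurableSpace Ω] {P : Measure Ω} {x : S → Ω → ℝ}

/-- The supremum of a centered Gaussian process over a countable set has no atom, if the process is
uniformly positively correlated with some fixed nondegenerate variable. -/
lemma measure_sup_eq_zero (hx : IsGaussianProcess x P)
    (h0 : ∀ s, ∫ ω, x s ω ∂P = 0) {C : Set S} (hC : C.Countable) {b : S}
    (hb : 0 < ∫ ω, x b ω * x b ω ∂P) {c : ℝ} (hc : 0 < c)
    (hcov : ∀ s ∈ C, c ≤ ∫ ω, x s ω * x b ω ∂P) (u : ℝ) :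
    P {ω | (∀ s ∈ C, x s ω ≤ u) ∧ ∀ k : ℕ, ∃ s ∈ C, u - 1 / (k + 1 : ℝ) < x s ω} = 0 := by
  classical
  have := hx.isProbabilityMeasure
  have hL : ∀ s, MemLp (x s) 2 P := fun s => (hx.hasGaussianLaw_eval s).memLp_two
  have hm : ∀ s, AEMeasurable (x s) P := hx.aemeasurable
  set v := ∫ ω, x b ω * x b ω ∂P with hv
  -- Regression on `x b`: the residual `Y s` is uncorrelated with `x b`, hence independent of it by
  -- joint Gaussianity.
  set ρ : S → ℝ := fun s => (∫ ω, x s ω * x b ω ∂P) / v with hρ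
  have hρc : ∀ s ∈ C, c / v ≤ ρ s := fun s hs => div_le_div_of_nonneg_right (hcov s hs) hb.le
  set Y : C → Ω → ℝ := fun s ω => x s ω - ρ s * x b ω with hY
  have hYm : ∀ s, AEMeasurable (Y s) P := fun s => (hm _).sub ((hm b).const_mul _)
  have hgauss : IsGaussianProcess (Sum.elim Y (fun _ : Unit => x b)) P := by
    refine hx.of_isGaussianProcess ?_
    rintro (s | _)
    · exact ⟨{(s : S), b}, ContinuousLinearMap.proj (R := ℝ) ⟨(s : S), by simp⟩
        - ρ s • ContinuousLinearMap.proj (R := ℝ) ⟨b, by simp⟩, fun ω => by simp [hY]⟩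
    · exact ⟨{b}, ContinuousLinearMap.proj (R := ℝ) ⟨b, by simp⟩, fun ω => by simp⟩
  have hind : IndepFun (fun ω (s : C) => Y s ω) (fun ω (_ : Unit) => x b ω) P := by
    refine hgauss.indepFun_of_covariance_eq_zero hYm (fun _ => hm b) fun s _ => ?_
    have hYL : MemLp (Y s) 2 P := (hL s).sub ((hL b).const_mul _)
    rw [covariance_eq_sub hYL (hL b), h0, mul_zero, sub_zero]
    have e : ∀ ω, (Y s * x b) ω = x s ω * x b ω - ρ s * (x b ω * x b ω) := fun ω => by
      simp only [hY, Pi.mul_apply]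
      ring
    simp_rw [e]
    rw [integral_sub (by exact (hL s).integrable_mul (hL b))
      (by exact ((hL b).integrable_mul (hL b)).const_mul _),
      integral_const_mul, ← hv, hρ]
    simp only
    rw [div_mul_cancel₀ _ hb.ne', sub_self]
  have hind' : IndepFun (fun ω (s : C) => Y s ω) (x b) P :=
    hind.comp (φ := id) (ψ := fun f : Unit → ℝ => f ()) measurable_id (measurable_pi_apply _)
  have hYm' : AEMeasurable (fun ω (s : C) => Y s ω) P := by
    have : Countable C := hC
    exact aemeasurable_pi_lambda _ hYm
  have hmap := (indepFun_iff_map_prod_eq_prod_map_map hYm' (hm b)).1 hind'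
  have : Countable C := hC
  set E : Set ((C → ℝ) × ℝ) := {z | (∀ s : C, z.1 s + ρ s * z.2 ≤ u) ∧
    ∀ k : ℕ, ∃ s : C, u - 1 / (k + 1 : ℝ) < z.1 s + ρ s * z.2} with hE
  have hEm : MeasurableSet E := by
    have hf : ∀ s : C, Measurable fun z : (C → ℝ) × ℝ => z.1 s + ρ s * z.2 := fun s => by fun_prop
    rw [hE, ofPred_and, ofPred_forall, ofPred_forall]
    refine (MeasurableSet.iInter fun s => measurableSet_le (hf s) measurable_const).inter
      (MeasurableSet.iInter fun k => ?_)
    rw [ofPred_exists]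
    exact MeasurableSet.iUnion fun s => measurableSet_lt measurable_const (hf s)
  have hset : {ω | (∀ s ∈ C, x s ω ≤ u) ∧ ∀ k : ℕ, ∃ s ∈ C, u - 1 / (k + 1 : ℝ) < x s ω}
      = (fun ω => ((fun s : C => Y s ω), x b ω)) ⁻¹' E := by
    ext ω
    simp [hE, hY]
  rw [hset, ← Measure.map_apply_of_aemeasurable (hYm'.prodMk (hm b)) hEm, hmap,
    Measure.measure_prod_null hEm]
  refine ae_of_all _ fun y => ?_
  have hna : NullSingletonClass (P.map (x b)) := by
    rw [(hx.hasGaussianLaw_eval b).map_eq_gaussianReal]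
    refine nullSingletonClass_gaussianReal ?_
    rw [variance_eq_sub (hL b), h0]
    have : ∫ ω, (x b ^ 2) ω ∂P = v := by simp [hv, sq]
    rw [this]
    simpa using hb
  refine Set.Subsingleton.measure_zero ?_ _
  -- For frozen residuals `y`, the supremum of `y s + ρ s * r` grows in `r` at rate at least `c / v
  -- > 0`, so it equals `u` for at most one `r`, a null set for the law of `x b`.
  have key : ∀ r r' : ℝ, (y, r) ∈ E → (y, r') ∈ E → ¬ r < r' := by
    intro r r' hr hr' hlt
    obtain ⟨k, hk⟩ := exists_nat_one_div_lt
      (show 0 < c / v * (r' - r) from mul_pos (div_pos hc hb) (sub_pos.2 hlt))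
    obtain ⟨s, hs⟩ := hr.2 k
    have h1 := hr'.1 s
    have h2 := mul_le_mul_of_nonneg_right (hρc s s.2) (sub_pos.2 hlt).le
    simp only at hs h1
    linarith
  intro r hr r' hr'
  exact le_antisymm (not_lt.1 (key r' r hr' hr)) (not_lt.1 (key r r' hr hr'))

end Supremum

/-! ### Slepian's inequality for arbitrary sets. -/

section ProbBelow

variable {d : ℕ} {Ω : Type*} [MeasurableSpace Ω] {P : Measure Ω}
  {x : EuclideanSpace ℝ (Fin d) → Ω → ℝ}

lemma probBelow_anti (P : Measure Ω) (x : EuclideanSpace ℝ (Fin d) → Ω → ℝ) (u : ℝ)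
    {A B : Set (EuclideanSpace ℝ (Fin d))} (h : A ⊆ B) :
    probBelow P x u B ≤ probBelow P x u A :=
  measure_mono fun _ hω s hs => hω s (h hs)

lemma probBelow_empty [IsProbabilityMeasure P] (u : ℝ) : probBelow P x u ∅ = 1 := by
  simp [probBelow]

lemma exists_countable_subset_dense {X : Type*} [TopologicalSpace X] [SecondCountableTopology X]
    [TopologicalSpace.PseudoMetrizableSpace X] (A : Set X) :
    ∃ C ⊆ A, C.Countable ∧ A ⊆ closure C :=
  (TopologicalSpace.IsSeparable.of_separableSpace A).exists_countable_dense_subset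

lemma exists_monotone_finset_iUnion_eq {X : Type*} {C : Set X} (hC : C.Countable) :
    ∃ F : ℕ → Finset X, Monotone F ∧ ⋃ n, (F n : Set X) = C := by
  classical
  rcases C.eq_empty_or_nonempty with rfl | hne
  · exact ⟨fun _ => ∅, fun _ _ _ => le_rfl, by simp⟩
  · obtain ⟨f, rfl⟩ := hC.exists_eq_range hne
    refine ⟨fun n => (Finset.range (n + 1)).image f, fun m n hmn => Finset.image_subset_image
      (Finset.range_mono (by omega)), ?_⟩
    ext y
    simp only [Finset.coe_image, mem_iUnion, mem_image, Finset.coe_range, mem_Iio, mem_range]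
    exact ⟨fun ⟨_, m, _, h⟩ => ⟨m, h⟩, fun ⟨m, h⟩ => ⟨m, m, by omega, h⟩⟩

lemma tendsto_measure_forall_lt {X : Type*} [IsFiniteMeasure P] {z : X → Ω → ℝ}
    (hz : ∀ s, AEMeasurable (z s) P) (u : ℝ) {F : ℕ → Finset X} (hF : Monotone F) {C : Set X}
    (hC : ⋃ n, (F n : Set X) = C) :
    Tendsto (fun n => P {ω | ∀ s ∈ F n, z s ω < u}) atTop (𝓝 (P {ω | ∀ s ∈ C, z s ω < u})) := by
  have h := tendsto_measure_iInter_atTop (μ := P) (s := fun n => {ω | ∀ s ∈ F n, z s ω < u})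
    (fun n => ?_) (fun m n hmn ω hω s hs => hω s (hF hmn hs)) ⟨0, measure_ne_top _ _⟩
  · have hset : {ω | ∀ s ∈ C, z s ω < u} = ⋂ n, {ω | ∀ s ∈ F n, z s ω < u} := by
      ext ω
      simp only [← hC, mem_iUnion, mem_iInter, mem_ofPred_eq, Finset.mem_coe]
      exact ⟨fun h n s hs => h s ⟨n, hs⟩, fun h s ⟨n, hs⟩ => h n s hs⟩
    rw [hset]
    exact h
  · have : {ω | ∀ s ∈ F n, z s ω < u} = ⋂ s ∈ F n, {ω | z s ω < u} := by ext; simp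
    rw [this]
    exact NullMeasurableSet.biInter (F n).countable_toSet fun s _ =>
      nullMeasurableSet_lt (hz s) aemeasurable_const

/-- Slepian's inequality for finite families of a Gaussian process. -/
lemma measure_forall_lt_finset_mul_le {X : Type*} {z : X → Ω → ℝ} (hz : IsGaussianProcess z P)
    (h0 : ∀ s, ∫ ω, z s ω ∂P = 0) (A B : Finset X)
    (hcov : ∀ s ∈ (A ∪ B : Set X), ∀ t ∈ (A ∪ B : Set X), 0 ≤ ∫ ω, z s ω * z t ω ∂P) (u : ℝ) :
    P {ω | ∀ s ∈ A, z s ω < u} * P {ω | ∀ s ∈ B, z s ω < u}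
      ≤ P {ω | ∀ s ∈ (A ∪ B : Set X), z s ω < u} := by
  classical
  have := hz.isProbabilityMeasure
  have hm : ∀ s, AEMeasurable (z s) P := hz.aemeasurable
  set I := A ∪ B with hI
  have hIm : AEMeasurable (fun ω => I.restrict (z · ω)) P :=
    aemeasurable_pi_lambda _ fun s => hm s
  set μ := P.map (fun ω => I.restrict (z · ω)) with hμdef
  have hμ : IsGaussian μ := (hz.hasGaussianLaw I).isGaussian_map
  have hμ0 : μ[id] = 0 := by
    funext i
    have h1 := IsGaussian.integral_dual (μ := μ) (ContinuousLinearMap.proj (R := ℝ) i)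
    simp only [ContinuousLinearMap.proj_apply] at h1
    simp only [id_eq, Pi.zero_apply]
    rw [← h1, hμdef, integral_map hIm (measurable_pi_apply i).aestronglyMeasurable]
    exact h0 i
  have hμcov : ∀ i j, 0 ≤ ∫ y, y i * y j ∂μ := fun i j => by
    rw [hμdef, integral_map hIm
      (by exact ((measurable_pi_apply i).mul (measurable_pi_apply j)).aestronglyMeasurable)]
    exact hcov i (by rw [← Finset.coe_union]; exact i.2) j (by rw [← Finset.coe_union]; exact j.2)
  have hsl := measureReal_orthant_mul_le hμ0 hμcov
    (Finset.univ.filter fun i : I => (i : X) ∈ A) (Finset.univ.filter fun i : I => (i : X) ∈ B) u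
  have hmeas : ∀ J : Finset I, MeasurableSet {y : I → ℝ | ∀ i ∈ J, y i < u} := fun J => by
    have : {y : I → ℝ | ∀ i ∈ J, y i < u} = ⋂ i ∈ J, {y | y i < u} := by ext; simp
    rw [this]
    exact Finset.measurableSet_biInter _ fun i _ =>
      measurableSet_lt (measurable_pi_apply i) measurable_const
  rw [measureReal_def, measureReal_def, measureReal_def, ← ENNReal.toReal_mul,
    ENNReal.toReal_le_toReal (by finiteness) (by finiteness), hμdef,
    Measure.map_apply_of_aemeasurable hIm (hmeas _),
    Measure.map_apply_of_aemeasurable hIm (hmeas _),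
    Measure.map_apply_of_aemeasurable hIm ((hmeas _).inter (hmeas _))] at hsl
  convert hsl using 3
  · ext ω
    simp only [mem_ofPred_eq, mem_preimage, Finset.mem_filter, Finset.mem_univ, true_and,
      Finset.restrict_def]
    exact ⟨fun h i hi => h i hi, fun h s hs => h ⟨s, by simp [hI, hs]⟩ hs⟩
  · ext ω
    simp only [mem_ofPred_eq, mem_preimage, Finset.mem_filter, Finset.mem_univ, true_and,
      Finset.restrict_def]
    exact ⟨fun h i hi => h i hi, fun h s hs => h ⟨s, by simp [hI, hs]⟩ hs⟩
  · ext ω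
    simp only [mem_ofPred_eq, mem_preimage, mem_inter_iff, Finset.mem_filter, Finset.mem_univ,
      true_and, Finset.restrict_def, mem_union, Finset.mem_coe]
    exact ⟨fun h => ⟨fun i hi => h i (Or.inl hi), fun i hi => h i (Or.inr hi)⟩,
      fun h s hs => hs.elim (fun hs => h.1 ⟨s, by simp [hI, hs]⟩ hs)
        (fun hs => h.2 ⟨s, by simp [hI, hs]⟩ hs)⟩

lemma probBelow_mul_le_of_countable (hx : IsGaussianProcess x P) (h0 : ∀ s, ∫ ω, x s ω ∂P = 0)
    {A B : Set (EuclideanSpace ℝ (Fin d))} (hA : A.Countable) (hB : B.Countable)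
    (hcov : ∀ s ∈ A ∪ B, ∀ t ∈ A ∪ B, 0 ≤ ∫ ω, x s ω * x t ω ∂P) (u : ℝ) :
    probBelow P x u A * probBelow P x u B ≤ probBelow P x u (A ∪ B) := by
  classical
  have := hx.isProbabilityMeasure
  obtain ⟨F, hF, rfl⟩ := exists_monotone_finset_iUnion_eq hA
  obtain ⟨G, hG, rfl⟩ := exists_monotone_finset_iUnion_eq hB
  have t1 := tendsto_measure_forall_lt (P := P) hx.aemeasurable u hF rfl
  have t2 := tendsto_measure_forall_lt (P := P) hx.aemeasurable u hG rfl
  have t3 := tendsto_measure_forall_lt (P := P) hx.aemeasurable u (hF.sup hG)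
    (C := (⋃ n, (F n : Set _)) ∪ ⋃ n, (G n : Set _)) (by
      simp [iUnion_union_distrib])
  have t12 := ENNReal.Tendsto.mul t1 (Or.inr (measure_ne_top _ _)) t2 (Or.inr (measure_ne_top _ _))
  refine le_of_tendsto_of_tendsto' t12 t3 fun n => ?_
  have hsub : (F n ∪ G n : Set (EuclideanSpace ℝ (Fin d)))
      ⊆ (⋃ n, (F n : Set (EuclideanSpace ℝ (Fin d)))) ∪ ⋃ n, (G n : Set _) :=
    union_subset_union (subset_iUnion (fun n => (F n : Set (EuclideanSpace ℝ (Fin d)))) n)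
      (subset_iUnion (fun n => (G n : Set (EuclideanSpace ℝ (Fin d)))) n)
  have h := measure_forall_lt_finset_mul_le hx h0 (F n) (G n) (fun s hs t ht => hcov s ?_ t ?_) u
  · simpa using h
  · exact hsub hs
  · exact hsub ht

/-- The probability of staying strictly below a level is determined by any dense subset, as long as
the process is nondegenerate on the larger set. -/
lemma probBelow_le_of_subset_closure (hx : IsGaussianProcess x P) (h0 : ∀ s, ∫ ω, x s ω ∂P = 0)
    (hcont : ∀ᵐ ω ∂P, Continuous fun s => x s ω) {A B : Set (EuclideanSpace ℝ (Fin d))}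
    (hBA : B ⊆ closure A) (hB : ∀ s ∈ B, 0 < ∫ ω, x s ω * x s ω ∂P) (u : ℝ) :
    probBelow P x u A ≤ probBelow P x u B := by
  obtain ⟨C, hCA, hC, hAC⟩ := exists_countable_subset_dense A
  have hcov := continuous_integral_mul hx h0 hcont
  -- The supremum argument needs a uniform lower bound on the covariance with a base point, which
  -- holds near each `b`. Second countability leaves countably many null events.
  have hnhds : ∀ b ∈ B, {s | (∫ ω, x b ω * x b ω ∂P) / 2 < ∫ ω, x s ω * x b ω ∂P} ∈ 𝓝[B] b := by
    intro b hb
    have hcb : Continuous fun s => ∫ ω, x s ω * x b ω ∂P :=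
      hcov.comp (continuous_id.prodMk continuous_const)
    exact mem_nhdsWithin_of_mem_nhds
      ((isOpen_lt continuous_const hcb).mem_nhds (half_lt_self (hB b hb)))
  obtain ⟨t, htB, ht, hBt⟩ := TopologicalSpace.countable_cover_nhdsWithin hnhds
  have hnull : ∀ b ∈ t, P {ω | (∀ s ∈ C ∩ {s | (∫ ω, x b ω * x b ω ∂P) / 2
      < ∫ ω, x s ω * x b ω ∂P}, x s ω ≤ u) ∧ ∀ k : ℕ, ∃ s ∈ C ∩ {s | (∫ ω, x b ω * x b ω ∂P) / 2
      < ∫ ω, x s ω * x b ω ∂P}, u - 1 / (k + 1 : ℝ) < x s ω} = 0 := fun b hb =>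
    measure_sup_eq_zero hx h0 (hC.mono inter_subset_left) (hB b (htB hb))
      (half_pos (hB b (htB hb))) (fun s hs => le_of_lt hs.2) u
  refine measure_mono_ae ?_
  filter_upwards [hcont, (ae_ball_iff ht).2 fun b hb => measure_eq_zero_iff_ae_notMem.1 (hnull b hb)]
    with ω hω hne hlt
  -- If `x b' ω ≥ u`, continuity forces values on `C` near `b'` arbitrarily close to `u`, while all
  -- of them are below `u`: the supremum over that piece is exactly `u`.
  intro b' hb'
  by_contra hge
  rw [not_lt] at hge
  obtain ⟨b, hbt, hb'b⟩ := mem_iUnion₂.1 (hBt hb')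
  refine hne b hbt ⟨fun s hs => le_of_lt (hlt s (hCA hs.1)), fun k => ?_⟩
  have hcb : Continuous fun s => ∫ ω, x s ω * x b ω ∂P :=
    hcov.comp (continuous_id.prodMk continuous_const)
  have hopen : IsOpen ({s | (∫ ω, x b ω * x b ω ∂P) / 2 < ∫ ω, x s ω * x b ω ∂P} ∩
      {s | u - 1 / (k + 1 : ℝ) < x s ω}) :=
    (isOpen_lt continuous_const hcb).inter (isOpen_lt continuous_const hω)
  have hmem : b' ∈ closure C := closure_minimal hAC isClosed_closure (hBA hb')
  have hlt' : u - 1 / (k + 1 : ℝ) < x b' ω := by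
    have : (0 : ℝ) < 1 / (k + 1 : ℝ) := by positivity
    linarith
  obtain ⟨s, ⟨hs1, hs2⟩, hsC⟩ := mem_closure_iff.1 hmem _ hopen ⟨hb'b, hlt'⟩
  exact ⟨s, ⟨hsC, hs1⟩, hs2⟩

/-- Slepian's inequality for sets: a nondegenerate Gaussian process with nonnegative covariances
stays below a level on a union with at least the product of the probabilities. -/
lemma probBelow_mul_le (hx : IsGaussianProcess x P) (h0 : ∀ s, ∫ ω, x s ω ∂P = 0)
    (hcont : ∀ᵐ ω ∂P, Continuous fun s => x s ω) {A B : Set (EuclideanSpace ℝ (Fin d))}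
    (hcov : ∀ s ∈ A ∪ B, ∀ t ∈ A ∪ B, 0 ≤ ∫ ω, x s ω * x t ω ∂P)
    (hvar : ∀ s ∈ A ∪ B, 0 < ∫ ω, x s ω * x s ω ∂P) (u : ℝ) :
    probBelow P x u A * probBelow P x u B ≤ probBelow P x u (A ∪ B) := by
  obtain ⟨A', hA'A, hA', hAA'⟩ := exists_countable_subset_dense A
  obtain ⟨B', hB'B, hB', hBB'⟩ := exists_countable_subset_dense B
  calc probBelow P x u A * probBelow P x u B
      ≤ probBelow P x u A' * probBelow P x u B' :=
        mul_le_mul' (probBelow_anti P x u hA'A) (probBelow_anti P x u hB'B)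
    _ ≤ probBelow P x u (A' ∪ B') := probBelow_mul_le_of_countable hx h0 hA' hB'
        (fun s hs t ht => hcov s (union_subset_union hA'A hB'B hs) t
          (union_subset_union hA'A hB'B ht)) u
    _ ≤ probBelow P x u (A ∪ B) := probBelow_le_of_subset_closure hx h0 hcont
        (by rw [closure_union]; exact union_subset_union hAA' hBB') hvar u

lemma prod_probBelow_le (hx : IsGaussianProcess x P) (h0 : ∀ s, ∫ ω, x s ω ∂P = 0)
    (hcont : ∀ᵐ ω ∂P, Continuous fun s => x s ω) {ι : Type*} (I : Finset ι)
    {A : ι → Set (EuclideanSpace ℝ (Fin d))}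
    (hcov : ∀ s ∈ ⋃ i, A i, ∀ t ∈ ⋃ i, A i, 0 ≤ ∫ ω, x s ω * x t ω ∂P)
    (hvar : ∀ s ∈ ⋃ i, A i, 0 < ∫ ω, x s ω * x s ω ∂P) (u : ℝ) :
    ∏ i ∈ I, probBelow P x u (A i) ≤ probBelow P x u (⋃ i ∈ I, A i) := by
  classical
  have := hx.isProbabilityMeasure
  induction I using Finset.induction_on with
  | empty => simp [probBelow_empty]
  | insert i I hi ih =>
    rw [Finset.prod_insert hi, Finset.set_biUnion_insert]
    have hsub : A i ∪ ⋃ j ∈ I, A j ⊆ ⋃ j, A j :=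
      union_subset (subset_iUnion A i) (iUnion₂_subset fun j _ => subset_iUnion A j)
    exact (mul_le_mul_right ih _).trans (probBelow_mul_le hx h0 hcont
      (fun s hs t ht => hcov s (hsub hs) t (hsub ht)) (fun s hs => hvar s (hsub hs)) u)

end ProbBelow

/-! ### Invariance under `Γ` and parquets. -/

section Homogeneous

variable {d : ℕ} {Ω : Type*} [MeasurableSpace Ω] {P : Measure Ω}
  {x : EuclideanSpace ℝ (Fin d) → Ω → ℝ}
  {Γ : Subgroup (EuclideanSpace ℝ (Fin d) ≃ₜ EuclideanSpace ℝ (Fin d))}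

lemma integral_mul_self_comp (hhom : IsHomogeneousIn P x Γ)
    {g : EuclideanSpace ℝ (Fin d) ≃ₜ EuclideanSpace ℝ (Fin d)} (hg : g ∈ Γ)
    (s : EuclideanSpace ℝ (Fin d)) :
    ∫ ω, x (g s) ω * x (g s) ω ∂P = ∫ ω, x s ω * x s ω ∂P := by
  have h := hhom g hg {s}
  have hm : Measurable fun y : ({s} : Finset (EuclideanSpace ℝ (Fin d))) → ℝ =>
      y ⟨s, by simp⟩ * y ⟨s, by simp⟩ := by fun_prop
  exact (h.comp hm).integral_eq

lemma measure_forall_lt_finset_comp (hhom : IsHomogeneousIn P x Γ)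
    {g : EuclideanSpace ℝ (Fin d) ≃ₜ EuclideanSpace ℝ (Fin d)} (hg : g ∈ Γ) (u : ℝ)
    (F : Finset (EuclideanSpace ℝ (Fin d))) :
    P {ω | ∀ s ∈ F, x (g s) ω < u} = P {ω | ∀ s ∈ F, x s ω < u} := by
  have hmeas : MeasurableSet {y : F → ℝ | ∀ i, y i < u} := by
    rw [ofPred_forall]
    exact MeasurableSet.iInter fun i => measurableSet_lt (measurable_pi_apply i) measurable_const
  have h := (hhom g hg F).measure_mem_eq hmeas
  simpa [preimage] using h

/-- Homogeneity in `Γ` gives invariance of the probabilities of staying below a level. -/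
lemma probBelow_le_probBelow_image (hx : IsGaussianProcess x P) (h0 : ∀ s, ∫ ω, x s ω ∂P = 0)
    (hcont : ∀ᵐ ω ∂P, Continuous fun s => x s ω) (hhom : IsHomogeneousIn P x Γ)
    {g : EuclideanSpace ℝ (Fin d) ≃ₜ EuclideanSpace ℝ (Fin d)} (hg : g ∈ Γ)
    {A : Set (EuclideanSpace ℝ (Fin d))} (hA : ∀ s ∈ A, 0 < ∫ ω, x s ω * x s ω ∂P) (u : ℝ) :
    probBelow P x u A ≤ probBelow P x u (g '' A) := by
  have := hx.isProbabilityMeasure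
  obtain ⟨C, hCA, hC, hAC⟩ := exists_countable_subset_dense A
  -- Homogeneity concerns finite-dimensional distributions, so it is transferred through finite
  -- subsets exhausting a countable dense one.
  have hCg : probBelow P x u (g '' C) = probBelow P x u C := by
    obtain ⟨F, hF, hFC⟩ := exists_monotone_finset_iUnion_eq hC
    have t1 := tendsto_measure_forall_lt (P := P) hx.aemeasurable u hF hFC
    have t2 := tendsto_measure_forall_lt (P := P) (z := fun s => x (g s))
      (fun s => hx.aemeasurable (g s)) u hF hFC
    simp_rw [measure_forall_lt_finset_comp hhom hg] at t2
    have h := tendsto_nhds_unique t2 t1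
    simpa [probBelow] using h
  calc probBelow P x u A ≤ probBelow P x u C := probBelow_anti P x u hCA
    _ = probBelow P x u (g '' C) := hCg.symm
    _ ≤ probBelow P x u (g '' A) := by
      refine probBelow_le_of_subset_closure hx h0 hcont ?_ ?_ u
      · rw [← g.image_closure]
        exact image_mono hAC
      · rintro _ ⟨s, hs, rfl⟩
        rw [integral_mul_self_comp hhom hg]
        exact hA s hs

/-- Supermultiplicativity of the probabilities of staying below a level along parquets. -/
lemma probBelow_pow_le_of_hasParquet (hx : IsGaussianProcess x P) (h0 : ∀ s, ∫ ω, x s ω ∂P = 0)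
    (hcont : ∀ᵐ ω ∂P, Continuous fun s => x s ω) (hhom : IsHomogeneousIn P x Γ)
    {A G : Set (EuclideanSpace ℝ (Fin d))} {n : ℕ} (hAG : HasParquet Γ A G n)
    (hA : ∀ s ∈ A, 0 < ∫ ω, x s ω * x s ω ∂P)
    (hG : ∀ s ∈ G, ∀ t ∈ G, 0 < ∫ ω, x s ω * x t ω ∂P) (u : ℝ) :
    probBelow P x u A ^ n ≤ probBelow P x u G := by
  obtain ⟨g, hg, -, hcl⟩ := hAG
  have hcov := continuous_integral_mul hx h0 hcont
  -- The tiles lie only in the closure of `G`, where strict positivity weakens to nonnegativity.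
  -- Nondegeneracy on the tiles comes from invariance instead.
  have hclos : ∀ z ∈ closure (G ×ˢ G), 0 ≤ ∫ ω, x z.1 ω * x z.2 ω ∂P := fun z hz =>
    closure_minimal (s := G ×ˢ G) (t := {z | 0 ≤ ∫ ω, x z.1 ω * x z.2 ω ∂P})
      (fun z hz => (hG z.1 hz.1 z.2 hz.2).le) (isClosed_le continuous_const hcov) hz
  have hsub : ∀ s ∈ ⋃ i, g i '' A, s ∈ closure G := fun s hs => hcl ▸ subset_closure hs
  have hprod := prod_probBelow_le hx h0 hcont Finset.univ (A := fun i => g i '' A)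
    (fun s hs t ht => hclos (s, t) (by
      rw [closure_prod_eq]
      exact ⟨hsub s hs, hsub t ht⟩))
    (fun s hs => by
      obtain ⟨i, r, hr, rfl⟩ := mem_iUnion.1 hs
      rw [integral_mul_self_comp hhom (hg i)]
      exact hA r hr) u
  calc probBelow P x u A ^ n = ∏ _i : Fin n, probBelow P x u A := by simp
    _ ≤ ∏ i : Fin n, probBelow P x u (g i '' A) := Finset.prod_le_prod' fun i _ =>
        probBelow_le_probBelow_image hx h0 hcont hhom (hg i) hA u
    _ ≤ probBelow P x u (⋃ i, g i '' A) := by simpa using hprod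
    _ ≤ probBelow P x u G := probBelow_le_of_subset_closure hx h0 hcont
        (hcl ▸ subset_closure) (fun s hs => hG s hs s hs) u

end Homogeneous

/-! ### Positive probability on bounded sets. -/

section Positivity

variable {d : ℕ} {Ω : Type*} [MeasurableSpace Ω] {P : Measure Ω}
  {x : EuclideanSpace ℝ (Fin d) → Ω → ℝ}

/-- If `Z ≥ u > 0` almost surely, the mean could not vanish; this covers degenerate `Z`. With
positive variance, Lebesgue measure is absolutely continuous with respect to the law. -/
lemma measure_lt_pos_of_hasGaussianLaw {Z : Ω → ℝ} (hZ : HasGaussianLaw Z P)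
    (h0 : ∫ ω, Z ω ∂P = 0) {u : ℝ} (hu : 0 < u ∨ 0 < ∫ ω, Z ω ^ 2 ∂P) :
    0 < P {ω | Z ω < u} := by
  have := hZ.isProbabilityMeasure
  have hL := hZ.memLp_two
  rcases hu with hu | hu
  · refine pos_iff_ne_zero.2 fun h => ?_
    have hae : ∀ᵐ ω ∂P, u ≤ Z ω := by
      filter_upwards [measure_eq_zero_iff_ae_notMem.1 h] with ω hω
      exact not_lt.1 hω
    have h1 := integral_mono_ae (integrable_const u) (hL.integrable (by norm_num)) hae
    simp only [integral_const, probReal_univ, one_smul] at h1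
    linarith
  · have hmap : P {ω | Z ω < u} = P.map Z (Iio u) :=
      (Measure.map_apply_of_aemeasurable hZ.aemeasurable measurableSet_Iio).symm
    have hv : Var[Z; P].toNNReal ≠ 0 := by
      rw [variance_eq_sub hL, h0]
      simpa using hu
    rw [hmap, hZ.map_eq_gaussianReal]
    refine pos_iff_ne_zero.2 fun h => ?_
    have h1 := gaussianReal_absolutelyContinuous' _ hv h
    simp at h1

/-- On a bounded set, a nonnegatively correlated Gaussian process stays below a level with positive
probability, if it does so at each single point of the closure. -/
lemma probBelow_pos_of_isBounded (hx : IsGaussianProcess x P) (h0 : ∀ s, ∫ ω, x s ω ∂P = 0)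
    (hcont : ∀ᵐ ω ∂P, Continuous fun s => x s ω) {A : Set (EuclideanSpace ℝ (Fin d))}
    (hA : Bornology.IsBounded A) (hcov : ∀ s ∈ A, ∀ t ∈ A, 0 < ∫ ω, x s ω * x t ω ∂P) {u : ℝ}
    (hu : 0 < u ∨ ∀ s ∈ closure A, 0 < ∫ ω, x s ω ^ 2 ∂P) :
    0 < probBelow P x u A := by
  have := hx.isProbabilityMeasure
  have hK : IsCompact (closure A) := hA.isCompact_closure
  have key : 0 < probBelow P x u (closure A ∩ A) := by
    -- Compactness induction: association carries positivity to finite unions, so only small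
    -- neighborhoods remain.
    refine hK.induction_on (p := fun W => 0 < probBelow P x u (W ∩ A)) ?_ ?_ ?_ ?_
    · simp [probBelow_empty]
    · exact fun s t hst ht => ht.trans_le (probBelow_anti P x u (inter_subset_inter_left _ hst))
    · intro s t hs ht
      rw [union_inter_distrib_right]
      have hsub : s ∩ A ∪ t ∩ A ⊆ A := union_subset inter_subset_right inter_subset_right
      exact (ENNReal.mul_pos hs.ne' ht.ne').trans_le (probBelow_mul_le hx h0 hcont
        (fun r hr r' hr' => (hcov r (hsub hr) r' (hsub hr')).le)
        (fun r hr => hcov r (hsub hr) r (hsub hr)) u)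
    · intro s hs
      have hpos : 0 < P {ω | x s ω < u} := measure_lt_pos_of_hasGaussianLaw
        (hx.hasGaussianLaw_eval s) (h0 s) (hu.imp_right fun h => h s hs)
      by_contra! hcon
      have hz : ∀ n : ℕ, probBelow P x u (Metric.ball s (1 / (n + 1 : ℝ)) ∩ A) = 0 := fun n =>
        le_antisymm (hcon _ (mem_nhdsWithin_of_mem_nhds
          (Metric.ball_mem_nhds s (by positivity)))) zero_le
      -- By path continuity, `x s ω < u` persists on some ball around `s`. If every ball had
      -- probability zero, the event at `s` would be null.
      refine hpos.ne' (measure_mono_null_ae (t := ⋃ n : ℕ,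
        {ω | ∀ r ∈ Metric.ball s (1 / (n + 1 : ℝ)) ∩ A, x r ω < u}) ?_ (measure_iUnion_null hz))
      filter_upwards [hcont] with ω hω hsu
      obtain ⟨ε, hε, hball⟩ := Metric.isOpen_iff.1 (isOpen_lt hω continuous_const) s hsu
      obtain ⟨n, hn⟩ := exists_nat_one_div_lt hε
      exact mem_iUnion.2 ⟨n, fun r hr => hball (Metric.ball_subset_ball hn.le hr.1)⟩
  rwa [inter_eq_right.2 subset_closure] at key

end Positivity

end GaussianParquet

theorem proposition1 {d : ℕ} {Ω : Type*} [MeasurableSpace Ω]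
    (P : Measure Ω) [IsProbabilityMeasure P]
    (x : EuclideanSpace ℝ (Fin d) → Ω → ℝ)
    (hGauss : IsGaussianProcess x P)
    (hcentered : ∀ s, ∫ ω, x s ω ∂P = 0)
    (hcont : ∀ᵐ ω ∂P, Continuous fun s => x s ω)
    (Γ : Subgroup (EuclideanSpace ℝ (Fin d) ≃ₜ EuclideanSpace ℝ (Fin d)))
    (hhom : IsHomogeneousIn P x Γ)
    (Δ : ℝ → Set (EuclideanSpace ℝ (Fin d)))
    (hmono : ∀ T T' : ℝ, 0 < T → T < T' → Δ T ⊆ Δ T')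
    (hpos : ∀ T : ℝ, 0 < T → ∀ s ∈ Δ T, ∀ t ∈ Δ T, 0 < ∫ ω, x t ω * x s ω ∂P)
    (r₁ r₂ D : ℕ) (hr₂ : 1 < r₂) (hr : r₂ < r₁)
    (hirr : Irrational (Real.log r₁ / Real.log r₂))
    (hparquet₁ : ∀ T : ℝ, 0 < T → HasParquet Γ (Δ (T / r₁)) (Δ T) (r₁ ^ D))
    (hparquet₂ : ∀ T : ℝ, 0 < T → HasParquet Γ (Δ (T / r₂)) (Δ T) (r₂ ^ D))
    (u : ℝ) :
    ∃ θ : EReal, 0 ≤ θ ∧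
      Tendsto (fun T : ℝ => -ENNReal.log (probBelow P x u (Δ T)) / ((T ^ D : ℝ) : EReal))
        atTop (𝓝 θ) ∧
      (θ < ⊤ ↔ ∃ T : ℝ, 0 < T ∧ 0 < probBelow P x u (Δ T)) ∧
      ((∀ T : ℝ, 0 < T → Bornology.IsBounded (Δ T)) →
        (0 < u ∨ ∀ T : ℝ, 0 < T → ∀ s ∈ closure (Δ T), 0 < ∫ ω, x s ω ^ 2 ∂P) →
        θ < ⊤) := by
  have hpos' : ∀ T : ℝ, 0 < T → ∀ s ∈ Δ T, ∀ t ∈ Δ T, 0 < ∫ ω, x s ω * x t ω ∂P :=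
    fun T hT s hs t ht => hpos T hT t ht s hs
  have hparquet : ∀ r : ℕ, 0 < r → (∀ T : ℝ, 0 < T → HasParquet Γ (Δ (T / r)) (Δ T) (r ^ D)) →
      ∀ T : ℝ, 0 < T → probBelow P x u (Δ (T / r)) ^ (r ^ D) ≤ probBelow P x u (Δ T) := by
    intro r hr0 h T hT
    have hr' : (0 : ℝ) < r := by exact_mod_cast hr0
    exact GaussianParquet.probBelow_pow_le_of_hasParquet hGauss hcentered hcont hhom (h T hT)
      (fun s hs => hpos' (T / r) (by positivity) s hs s hs) (hpos' T hT) u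
  obtain ⟨θ, hθ0, hθ, hiff⟩ := GaussianParquet.exists_tendsto_neg_log_div_pow (D := D) hr₂ hr hirr
    (p := fun T => probBelow P x u (Δ T)) (fun T => prob_le_one)
    (fun T T' hT hTT' => GaussianParquet.probBelow_anti P x u (hmono T T' hT hTT'))
    (hparquet r₁ (by omega) hparquet₁) (hparquet r₂ (by omega) hparquet₂)
  refine ⟨θ, hθ0, hθ, hiff, fun hbdd hu => hiff.2 ⟨1, one_pos, ?_⟩⟩
  exact GaussianParquet.probBelow_pos_of_isBounded hGauss hcentered hcont (hbdd 1 one_pos)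
    (hpos' 1 one_pos) (hu.imp_right fun h => h 1 one_pos)
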